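/- Let $k\ge 1$, $m=2k+2$, $\sigma,\epsilon>0$, $I=[0,1]$, let $T=\{t_1<\dots<t_k\}\subset(0,1)$ and $s_1<\dots<s_m$ be real, and put $g(x)=e^{-x^2/\sigma^2}$, $\phi_j(x)=g(x-s_j)$. For $r>0$ let $T_{i,r}=\{x\in I:|x-t_i|\le r\}$ and $T_r=\bigcup_i T_{i,r}$. **T\*-systems.** Functions $u_0,\dots,u_m$ ($m$ even, $m\ge 2k+2$) form a T\*-system on $I$ (with respect to $T$) if the following holds as $\rho\to0^+$, uniformly over all sequences $0=\tau_0<\tau_1<\dots<\tau_m=1$ such that all $\tau_p$ except exactly three, namely $\tau_0$, $\tau_m$ and some $\tau_{\underline l}\in(0,1)$, belong to $T_\rho$, and every $T_{i,\rho}$ contains an even nonzero number of the points: (1) $\det[u_j(\tau_p)]_{p,j=0}^m\ge0$ for all small enough $\rho$; (2) all minors of $[u_j(\tau_p)]$ along the row of $\tau_{\underline l}$ tend to zero at the same rate, i.e. for all small enough $\rho$ they are nonzero and bounded by a constant multiple of each other, and they tend to $0$. **Functions.** For $f_0,f_1,\bar f>0$ let $F(0)=f_0$, $F(1)=f_1$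 and, for $x\in(0,1)$, $F(x)=0$ if $x\in T_\epsilon$ and $F(x)=\bar f$ otherwise. For $\pi\in\{\pm1\}^k$ and $e\in\{\bar f,-\bar f\}$ let $F^\pi(0)=f_0$, $F^\pi(1)=f_1$ and, for $x\in(0,1)$, $F^\pi(x)=\pi_i$ if $x\in T_{i,\epsilon}$ and $F^\pi(x)=e$ if $x\notin T_\epsilon$. (At a common end point of two of the $T_{i,\epsilon}$, one of the two values is taken.) **Minors.** For $a,b\in I$ let $N(a,b)$ be the $m\times m$ determinant whose rows are $(g(a-s_j))_j$, then $(g(t_i-s_j))_j,\ (g'(t_i-s_j))_j$ for $i=1,\dots,k$, then $(g(b-s_j))_j$. For $j\in\{1,\dots,m\}$ let $N_{j,0}$ be the $(m-1)\times(m-1)$ determinant with the $2k$ rows of the $t_i$ followed by the row $(g(1-s_{j'}))_{j'}$, and $N_{j,1}$ the one with the row $(g(0-s_{j'}))_{j'}$ followed by the $2k$ rows of the $t_i$, where in both the column of $s_j$ is omitted. Consider the conditions $$\text{(A)}\quad \frac{f_0}{\bar f}>\sup_{x\in(0,1)\setminus T_\epsilon}\frac{N(0,1)-\frac{f_1}{\bar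 f}N(0,x)}{N(x,1)},\qquad\qquad \text{(B)}\quad \frac{f_0}{f_1}>\frac{N_{j,1}}{N_{j,0}}\quad\text{for all } j .$$ **Claim.** (i) For all $f_0,f_1,\bar f>0$ satisfying (A) and (B), $\{F\}\cup\{\phi_j\}_{j=1}^m$ form a T\*-system on $I$. (ii) There is $R>0$, depending only on $k,\sigma,\epsilon,T$ and $(s_j)_j$, such that for all $f_0,f_1,\bar f>0$ with $f_0/\bar f>R$ and $f_0/f_1>R$: conditions (A) and (B) hold whenever $\bar f<f_1$; and if moreover $f_0>R$, $T_{i,\epsilon}\subset(0,1)$ for all $i$ and $t_{i+1}-t_i\ge2\epsilon$ for all $i<k$, then for every sign pattern $\pi$ and every $e\in\{\bar f,-\bar f\}$ with $e<f_1$, $\{F^\pi\}\cup\{\phi_j\}_{j=1}^m$ form a T\*-system on $I$. -/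

import Mathlib

noncomputable section

/-- The Gaussian `g(x) = exp (-x² / σ²)`. -/
def gaussianFn (σ x : ℝ) : ℝ := Real.exp (-(x ^ 2) / σ ^ 2)

/-- The Gaussian windows `φ_j(x) = g(x - s_j)`. -/
def gaussianWindow {n : ℕ} (σ : ℝ) (s : Fin n → ℝ) (j : Fin n) (x : ℝ) : ℝ :=
  gaussianFn σ (x - s j)

/-- The closed `r`-neighbourhood `T_{i,r} = {x ∈ [0,1] : |x - t_i| ≤ r}` of the point `t_i`. -/
def nbhd {k : ℕ} (t : Fin k → ℝ) (r : ℝ) (i : Fin k) : Set ℝ :=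
  {x | x ∈ Set.Icc (0 : ℝ) 1 ∧ |x - t i| ≤ r}

/-- The `r`-neighbourhood `T_r = ⋃ i, T_{i,r}` of `T = {t_1, …, t_k}`. -/
def nbhdAll {k : ℕ} (t : Fin k → ℝ) (r : ℝ) : Set ℝ := ⋃ i, nbhd t r i

/-- Admissible configurations at scale `ρ`: `0 = τ_0 < τ_1 < ⋯ < τ_m = 1`; all of these points
except exactly three, namely `τ_0`, `τ_m` and the interior point `τ_l`, lie in `T_ρ`; and every
`T_{i,ρ}` contains an even and nonzero number of the points. -/
structure IsAdmissible {k m : ℕ} (t : Fin k → ℝ) (ρ : ℝ) (τ : Fin (m + 1) → ℝ)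
    (l : Fin (m + 1)) : Prop where
  strictMono : StrictMono τ
  first : τ 0 = 0
  last : τ (Fin.last m) = 1
  interior : τ l ∈ Set.Ioo (0 : ℝ) 1
  first_notMem : τ 0 ∉ nbhdAll t ρ
  last_notMem : τ (Fin.last m) ∉ nbhdAll t ρ
  exceptional_notMem : τ l ∉ nbhdAll t ρ
  mem : ∀ p, p ≠ 0 → p ≠ l → p ≠ Fin.last m → τ p ∈ nbhdAll t ρ
  even : ∀ i, Even {p | τ p ∈ nbhd t ρ i}.ncard
  nonempty : ∀ i, {p | τ p ∈ nbhd t ρ i}.Nonempty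

/-- The matrix `[u_j(τ_p)]`, with rows indexed by `p` and columns by `j`. -/
def collocation {n : ℕ} (u : Fin n → ℝ → ℝ) (τ : Fin n → ℝ) : Matrix (Fin n) (Fin n) ℝ :=
  Matrix.of fun p j => u j (τ p)

/-- The minor of `M` obtained by deleting row `l` and column `j`. -/
def minor {m : ℕ} (M : Matrix (Fin (m + 1)) (Fin (m + 1)) ℝ) (l j : Fin (m + 1)) : ℝ :=
  (M.submatrix l.succAbove j.succAbove).det

/-- The functions `u_0, …, u_m` form a T*-system on `[0,1]` with respect to
`T = {t_1, …, t_k}`: as `ρ → 0`, uniformly over all configurations admissible at scale `ρ`,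
* the determinant of `[u_j(τ_p)]` is nonnegative (once `ρ` is small), and
* all minors along the row of the exceptional point `τ_l` tend to zero at the same rate: they
  are nonzero, tend to zero, and are bounded by constant multiples of each other. -/
structure IsTStarSystem {k m : ℕ} (t : Fin k → ℝ) (u : Fin (m + 1) → ℝ → ℝ) : Prop where
  even : Even m
  card_le : 2 * k + 2 ≤ m
  det_nonneg : ∃ ρ₀ > (0 : ℝ), ∀ ρ, 0 < ρ → ρ < ρ₀ → ∀ τ l, IsAdmissible t ρ τ l →
    0 ≤ (collocation u τ).det
  minor_tendsto : ∀ δ > (0 : ℝ), ∃ ρ₀ > (0 : ℝ), ∀ ρ, 0 < ρ → ρ < ρ₀ → ∀ τ l,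
    IsAdmissible t ρ τ l → ∀ j, |minor (collocation u τ) l j| ≤ δ
  minor_rate : ∃ C > (0 : ℝ), ∃ ρ₀ > (0 : ℝ), ∀ ρ, 0 < ρ → ρ < ρ₀ → ∀ τ l,
    IsAdmissible t ρ τ l → ∀ j, minor (collocation u τ) l j ≠ 0 ∧
      ∀ j', |minor (collocation u τ) l j| ≤ C * |minor (collocation u τ) l j'|

open Classical in
/-- The function `F`: it equals `f₀` at `0`, `f₁` at `1`, `0` on the rest of `T_ε`, and `fbar`
elsewhere. -/
def dualF {k : ℕ} (f₀ f₁ fbar ε : ℝ) (t : Fin k → ℝ) (x : ℝ) : ℝ :=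
  if x = 0 then f₀ else if x = 1 then f₁ else if x ∈ nbhdAll t ε then 0 else fbar

open Classical in
/-- The function `F^π` for a sign pattern `π`: it equals `f₀` at `0`, `f₁` at `1`, `π_i` on the
rest of `T_{i,ε}`, and `e` elsewhere. (For a common end point of two neighbourhoods, one of the two
indices is picked.) -/
def dualFSign {k : ℕ} (f₀ f₁ e ε : ℝ) (t : Fin k → ℝ) (π : Fin k → ℤˣ) (x : ℝ) : ℝ :=
  if x = 0 then f₀ else if x = 1 then f₁ else
    if h : ∃ i, x ∈ nbhd t ε i then (((π h.choose : ℤˣ) : ℤ) : ℝ) else e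

/-- The `2k` rows `g(t_1 - s_j), g'(t_1 - s_j), …, g(t_k - s_j), g'(t_k - s_j)`. -/
def supportRows {k n : ℕ} (σ : ℝ) (t : Fin k → ℝ) (s : Fin n → ℝ) :
    Fin (2 * k) → Fin n → ℝ := fun r j =>
  if (r : ℕ) % 2 = 0 then gaussianFn σ (t ⟨r / 2, by omega⟩ - s j)
  else deriv (gaussianFn σ) (t ⟨r / 2, by omega⟩ - s j)

/-- The row `g(a - s_j)`. -/
def pointRow {n : ℕ} (σ : ℝ) (s : Fin n → ℝ) (a : ℝ) : Fin n → ℝ := fun j => gaussianFn σ (a - s j)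

/-- The determinant with rows `g(a - s_j)`, then the `2k` rows of the support points, then
`g(b - s_j)`. Moving a row past the two rows of a support point does not change the sign, so the
position of a row relative to the pairs of rows of the support points is immaterial. -/
def borderedDet {k : ℕ} (σ : ℝ) (t : Fin k → ℝ) (s : Fin (2 * k + 2) → ℝ) (a b : ℝ) : ℝ :=
  Matrix.det (Matrix.of
    (Fin.snoc (α := fun _ => Fin (2 * k + 2) → ℝ)
      (Fin.cons (α := fun _ => Fin (2 * k + 2) → ℝ) (pointRow σ s a) (supportRows σ t s) :
        Fin (2 * k + 1) → Fin (2 * k + 2) → ℝ)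
      (pointRow σ s b) : Fin (2 * k + 2) → Fin (2 * k + 2) → ℝ))

/-- `N_{l,j+1,0}`: the determinant with the rows of the support points, then `g(1 - s_i)`,
the sample `s_j` being omitted. -/
def minorAtOne {k : ℕ} (σ : ℝ) (t : Fin k → ℝ) (s : Fin (2 * k + 2) → ℝ)
    (j : Fin (2 * k + 2)) : ℝ :=
  Matrix.det (Matrix.of
    (Fin.snoc (α := fun _ => Fin (2 * k + 1) → ℝ) (supportRows σ t (s ∘ j.succAbove))
      (pointRow σ (s ∘ j.succAbove) 1) : Fin (2 * k + 1) → Fin (2 * k + 1) → ℝ))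

/-- `N_{l,j+1,1}`: the determinant with the row `g(0 - s_i)`, then the rows of the support points,
the sample `s_j` being omitted. -/
def minorAtZero {k : ℕ} (σ : ℝ) (t : Fin k → ℝ) (s : Fin (2 * k + 2) → ℝ)
    (j : Fin (2 * k + 2)) : ℝ :=
  Matrix.det (Matrix.of
    (Fin.cons (α := fun _ => Fin (2 * k + 1) → ℝ) (pointRow σ (s ∘ j.succAbove) 0)
      (supportRows σ t (s ∘ j.succAbove)) : Fin (2 * k + 1) → Fin (2 * k + 1) → ℝ))

/-- `f₀ / fbar` exceeds the supremum of `(N_{l,1} - (f₁/fbar) N_{m+1,1}(x)) / N_{1,1}(x)` over the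
points `x` of the open interval outside `T_ε`. Here `N_{l,1} = borderedDet 0 1`,
`N_{1,1}(x) = borderedDet x 1`, `N_{m+1,1}(x) = borderedDet 0 x` are the minors along the first
column of the limiting matrix, obtained by deleting the row of `x`, of `0`, of `1`. -/
def FBarCondition {k : ℕ} (σ ε : ℝ) (t : Fin k → ℝ) (s : Fin (2 * k + 2) → ℝ)
    (f₀ f₁ fbar : ℝ) : Prop :=
  ∃ c < f₀ / fbar, ∀ x ∈ Set.Ioo (0 : ℝ) 1 \ nbhdAll t ε,
    (borderedDet σ t s 0 1 - f₁ / fbar * borderedDet σ t s 0 x) / borderedDet σ t s x 1 ≤ c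

/-- `f₀ / f₁` exceeds `N_{l,j+1,1} / N_{l,j+1,0}` for every `j`. -/
def FOneCondition {k : ℕ} (σ : ℝ) (t : Fin k → ℝ) (s : Fin (2 * k + 2) → ℝ) (f₀ f₁ : ℝ) : Prop :=
  ∀ j, minorAtZero σ t s j / minorAtOne σ t s j < f₀ / f₁

/-- The family `u, φ_1, …, φ_n`. -/
def withWindows {n : ℕ} (σ : ℝ) (s : Fin n → ℝ) (u : ℝ → ℝ) : Fin (n + 1) → ℝ → ℝ :=
  Fin.cons (α := fun _ => ℝ → ℝ) u (gaussianWindow σ s)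

end

/-!
For points `x, 0, 1` and pairs `p_i < q_i` close to the `t_i`, all determinants in question are
compared with Vandermonde determinants of the same points.

*Total positivity with constants.* For increasing exponents, `det [exp (y_j x_i)]` lies above a
positive multiple of the Vandermonde determinant of the `x_i`
(`exists_vandermonde_le_det_exp`), and a determinant of exponentials and one smooth function is
bounded in absolute value by a multiple of it (`exists_det_exp_snoc_le_vandermonde`). Both follow by
induction: dividing by the first exponential makes a column constant, and
`det_collocation_cons_one_le` integrates an inequality between determinants of the derivatives.
A Gaussian window is an exponential times a factor depending on `x` only, so these bounds pass to
the windows. They are uniform as points coalesce. The product of two determinants with the same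
points does not depend on the order of the points, which replaces any count of signs of
permutations.

*Confluent pairs.* Subtracting rows within each pair takes the factor `∏ (q_i - p_i)` out of a
determinant and leaves one that is continuous up to `p = q = t`, where it is one of the
determinants `N` (`det_window_nodes₂`, `borderedDet_eq`). By the lower bound these limits are
positive.

*The criterion.* An admissible configuration consists of `0`, `1`, the exceptional point and one
pair for each `t_i`, so the T*-property reduces to statements about `p, q` in a neighbourhood of
`(t, t)` (`isTStarSystem_of_eventually`).

*The function `F`.* Expansion along its column gives `f₀ N(x,1) + f₁ N(0,x) - F(x) N(0,1)` in the
limit. Compactness turns the limiting condition into one for nearby pairs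
(`eventually_windowDet_nonneg`); only at `x = 1` can equality occur, and there a factor `1 - x`
splits off. The minors have the limits `f₀ N_{j,0} - f₁ N_{j,1}`, which are positive.

*The functions `F^π`.* Subtracting a smooth function that equals `π_i` near `t_i` removes the values
at the pairs. The determinant of the smooth function is bounded by the Vandermonde determinant,
hence by the term of `f₀` once `f₀` is large, even when `x` is close to a pair
(`exists_det_dualFSign_nonpos`).
-/

open Filter Topology

/-! ### Comparison of collocation determinants by integration -/

theorem hasDerivAt_det_updateRow {n : ℕ} (A : Matrix (Fin n) (Fin n) ℝ) (i : Fin n)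
    {v : ℝ → Fin n → ℝ} {v' : Fin n → ℝ} {b : ℝ}
    (h : ∀ j, HasDerivAt (fun y => v y j) (v' j) b) :
    HasDerivAt (fun y => (A.updateRow i (v y)).det) (A.updateRow i v').det b := by
  have key : ∀ w : Fin n → ℝ, (A.updateRow i w).det = ∑ j, A.transpose.adjugate i j * w j := by
    intro w
    rw [← Matrix.cramer_transpose_apply, Matrix.cramer_eq_adjugate_mulVec]
    rfl
  simp only [key]
  exact HasDerivAt.fun_sum fun j _ => (h j).const_mul _

/-- Subtracting consecutive rows removes a constant first column. -/
theorem det_collocation_cons_one {n : ℕ} (f : Fin n → ℝ → ℝ) (x : Fin (n + 1) → ℝ) :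
    (collocation (Fin.cons (α := fun _ => ℝ → ℝ) (fun _ => 1) f) x).det =
      (Matrix.of fun i j : Fin n => f j (x i.succ) - f j (x i.castSucc)).det := by
  set A := collocation (Fin.cons (α := fun _ => ℝ → ℝ) (fun _ => 1) f) x with hA
  let B : Matrix (Fin (n + 1)) (Fin (n + 1)) ℝ := Matrix.of fun i j =>
    Fin.cases (motive := fun _ => ℝ) (A 0 j) (fun i' => A i'.succ j - A i'.castSucc j) i
  have h1 : A.det = B.det := by
    apply Matrix.det_eq_of_forall_row_eq_smul_add_pred (fun _ => 1)
    · intro j; rfl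
    · intro i j; simp [B]
  rw [h1, Matrix.det_succ_column_zero, Fin.sum_univ_succ]
  have h2 : ∀ i : Fin n, B i.succ 0 = 0 := by
    intro i; simp [B, hA, collocation]
  have h3 : B 0 0 = 1 := by simp [B, hA, collocation]
  simp only [h2, h3]
  simp only [Fin.val_zero, pow_zero, mul_one, one_mul, mul_zero, zero_mul, Finset.sum_const_zero,
    add_zero]
  congr 1

/-- The matrix whose rows with index below `r` are increments of `f` between consecutive nodes,
and whose remaining rows are values of `f'` at the points `ξ`. -/
def incrementMatrix {n : ℕ} (f f' : Fin n → ℝ → ℝ) (x : Fin (n + 1) → ℝ) (r : ℕ)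
    (ξ : Fin n → ℝ) : Matrix (Fin n) (Fin n) ℝ :=
  Matrix.of fun i j => if (i : ℕ) < r then f j (x i.succ) - f j (x i.castSucc) else f' j (ξ i)

theorem incrementMatrix_succ {n : ℕ} (f f' : Fin n → ℝ → ℝ) (x : Fin (n + 1) → ℝ) (i : Fin n)
    (ξ : Fin n → ℝ) : incrementMatrix f f' x (i + 1) ξ =
      (incrementMatrix f f' x i ξ).updateRow i fun j => f j (x i.succ) - f j (x i.castSucc) := by
  ext a j
  by_cases h : a = i
  · subst h; simp [incrementMatrix]
  · have h' : (a : ℕ) ≠ i := fun h' => h (Fin.ext h')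
    have : ((a : ℕ) < i + 1) = ((a : ℕ) < i) := by
      apply propext; omega
    simp only [incrementMatrix, Matrix.of_apply, Matrix.updateRow_apply, h, if_false, this]

theorem incrementMatrix_update {n : ℕ} (f f' : Fin n → ℝ → ℝ) (x : Fin (n + 1) → ℝ) (i : Fin n)
    (ξ : Fin n → ℝ) (b : ℝ) : incrementMatrix f f' x i (Function.update ξ i b) =
      (incrementMatrix f f' x i ξ).updateRow i fun j => f' j b := by
  ext a j
  by_cases h : a = i
  · subst h; simp [incrementMatrix]
  · simp [incrementMatrix, Matrix.updateRow_apply, h]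

/-- The rows are integrated one at a time: in each row, the increments over `[x_i, b]` have
derivative `f'(b)` in `b`, so an inequality of determinants survives by monotonicity. -/
theorem det_incrementMatrix_le {n : ℕ} {f f' p p' : Fin n → ℝ → ℝ}
    (hf : ∀ j y, HasDerivAt (f j) (f' j y) y) (hp : ∀ j y, HasDerivAt (p j) (p' j y) y)
    {α β a b : ℝ}
    (h : ∀ ξ : Fin n → ℝ, Monotone ξ → (∀ i, ξ i ∈ Set.Icc α β) →
      a * (collocation f' ξ).det ≤ b * (collocation p' ξ).det)
    {x : Fin (n + 1) → ℝ} (hx : Monotone x) (hxm : ∀ i, x i ∈ Set.Icc α β) :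
    ∀ r ≤ n, ∀ ξ : Fin n → ℝ, (∀ i, ξ i ∈ Set.Icc (x i.castSucc) (x i.succ)) →
      a * (incrementMatrix f f' x r ξ).det ≤ b * (incrementMatrix p p' x r ξ).det := by
  intro r
  induction r with
  | zero =>
    intro _ ξ hξ
    have h0 := h ξ ?_ fun i => ⟨(hxm _).1.trans (hξ i).1, (hξ i).2.trans (hxm _).2⟩
    · simpa [incrementMatrix, collocation] using h0
    · intro a b hab
      rcases hab.eq_or_lt with rfl | hlt
      · exact le_rfl
      · refine (hξ a).2.trans ((hx ?_).trans (hξ b).1)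
        rw [Fin.le_def]; simpa using hlt
  | succ r ih =>
    intro hr ξ hξ
    let i : Fin n := ⟨r, hr⟩
    have hmono : x i.castSucc ≤ x i.succ := hx (by rw [Fin.le_def]; simp)
    let G : ℝ → ℝ := fun y =>
      b * ((incrementMatrix p p' x r ξ).updateRow i fun j => p j y - p j (x i.castSucc)).det -
      a * ((incrementMatrix f f' x r ξ).updateRow i fun j => f j y - f j (x i.castSucc)).det
    have hG : ∀ y, HasDerivAt G
        (b * ((incrementMatrix p p' x r ξ).updateRow i fun j => p' j y).det -
         a * ((incrementMatrix f f' x r ξ).updateRow i fun j => f' j y).det) y := fun y =>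
      ((hasDerivAt_det_updateRow _ _ fun j => (hp j y).sub_const _).const_mul b).sub
        ((hasDerivAt_det_updateRow _ _ fun j => (hf j y).sub_const _).const_mul a)
    have hGm : MonotoneOn G (Set.Icc (x i.castSucc) (x i.succ)) := by
      apply monotoneOn_of_deriv_nonneg (convex_Icc _ _)
      · exact fun y _ => (hG y).continuousAt.continuousWithinAt
      · exact fun y _ => (hG y).differentiableAt.differentiableWithinAt
      · intro y hy
        rw [interior_Icc] at hy
        rw [(hG y).deriv, sub_nonneg]
        have := ih (by omega) (Function.update ξ i y) (by
          intro l
          by_cases hl : l = i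
          · subst hl; simpa using ⟨hy.1.le, hy.2.le⟩
          · simpa [hl] using hξ l)
        rwa [incrementMatrix_update f f' x i, incrementMatrix_update p p' x i] at this
    have h0 : G (x i.castSucc) = 0 := by
      simp only [G, sub_self]
      rw [Matrix.det_eq_zero_of_row_eq_zero i (by simp),
        Matrix.det_eq_zero_of_row_eq_zero i (by simp), mul_zero, mul_zero, sub_zero]
    have h1 := hGm (Set.left_mem_Icc.2 hmono) (Set.right_mem_Icc.2 hmono) hmono
    rw [h0] at h1
    have e1 := incrementMatrix_succ f f' x i ξ
    have e2 := incrementMatrix_succ p p' x i ξ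
    change incrementMatrix f f' x (r + 1) ξ = _ at e1
    change incrementMatrix p p' x (r + 1) ξ = _ at e2
    rw [e1, e2]
    exact sub_nonneg.1 h1

/-- Comparison of determinants by integration: an inequality between the collocation determinants
of the derivatives, at all increasing nodes, passes to the functions themselves once a constant
column is added. -/
theorem det_collocation_cons_one_le {n : ℕ} {f f' p p' : Fin n → ℝ → ℝ}
    (hf : ∀ j y, HasDerivAt (f j) (f' j y) y) (hp : ∀ j y, HasDerivAt (p j) (p' j y) y)
    {α β a b : ℝ}
    (h : ∀ ξ : Fin n → ℝ, Monotone ξ → (∀ i, ξ i ∈ Set.Icc α β) →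
      a * (collocation f' ξ).det ≤ b * (collocation p' ξ).det)
    {x : Fin (n + 1) → ℝ} (hx : Monotone x) (hxm : ∀ i, x i ∈ Set.Icc α β) :
    a * (collocation (Fin.cons (α := fun _ => ℝ → ℝ) (fun _ => 1) f) x).det ≤
      b * (collocation (Fin.cons (α := fun _ => ℝ → ℝ) (fun _ => 1) p) x).det := by
  rw [det_collocation_cons_one, det_collocation_cons_one]
  have := det_incrementMatrix_le hf hp h hx hxm n le_rfl (fun i => x i.castSucc) fun i =>
    Set.left_mem_Icc.2 (hx (by rw [Fin.le_def]; simp))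
  simpa [incrementMatrix] using this

/-- The Vandermonde determinant is the collocation determinant of the monomials. -/
theorem det_vandermonde_eq_collocation {n : ℕ} (x : Fin n → ℝ) :
    (Matrix.vandermonde x).det = (collocation (fun j y => y ^ (j : ℕ)) x).det := rfl

theorem vandermonde_nonneg_of_monotone {n : ℕ} {x : Fin n → ℝ} (hx : Monotone x) :
    0 ≤ (Matrix.vandermonde x).det := by
  rw [Matrix.det_vandermonde]
  exact Finset.prod_nonneg fun i _ => Finset.prod_nonneg fun j hj =>
    sub_nonneg.2 (hx (Finset.mem_Ioi.1 hj).le)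

theorem vandermonde_pos_of_strictMono {n : ℕ} {x : Fin n → ℝ} (hx : StrictMono x) :
    0 < (Matrix.vandermonde x).det := by
  rw [Matrix.det_vandermonde]
  exact Finset.prod_pos fun i _ => Finset.prod_pos fun j hj => sub_pos.2 (hx (Finset.mem_Ioi.1 hj))

/-- The antiderivatives `y ^ (j + 1) / (j + 1)` of the monomials, with a constant column, give a
positive multiple of the Vandermonde determinant. -/
theorem det_collocation_cons_one_monomials {n : ℕ} (x : Fin (n + 1) → ℝ) :
    (collocation (Fin.cons (α := fun _ => ℝ → ℝ) (fun _ => 1)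
      fun (j : Fin n) y => y ^ ((j : ℕ) + 1) / ((j : ℕ) + 1)) x).det =
      (∏ j : Fin n, (((j : ℕ) : ℝ) + 1)⁻¹) * (Matrix.vandermonde x).det := by
  have := Matrix.det_mul_row (Fin.cons (α := fun _ => ℝ) 1 fun j : Fin n => (((j : ℕ) : ℝ) + 1)⁻¹)
    (Matrix.vandermonde x)
  rw [Fin.prod_univ_succ] at this
  simp only [Fin.cons_zero, Fin.cons_succ, one_mul] at this
  rw [← this]
  congr 1
  ext i j
  refine Fin.cases ?_ (fun j => ?_) j
  · simp [collocation, Matrix.vandermonde]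
  · simp [collocation, Matrix.vandermonde]; ring

theorem hasDerivAt_monomial (j : ℕ) (y : ℝ) :
    HasDerivAt (fun y : ℝ => y ^ (j + 1) / ((j : ℝ) + 1)) (y ^ j) y := by
  have h : (j : ℝ) + 1 ≠ 0 := by positivity
  have e : y ^ j = ((j + 1 : ℕ) : ℝ) * y ^ (j + 1 - 1) / ((j : ℝ) + 1) := by
    rw [Nat.add_sub_cancel]; push_cast; field_simp
  rw [e]
  exact (hasDerivAt_pow (j + 1) y).div_const ((j : ℝ) + 1)

/-! ### Exponentials compared with the Vandermonde determinant -/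

theorem det_collocation_const_mul {n : ℕ} (c : Fin n → ℝ) (f : Fin n → ℝ → ℝ) (x : Fin n → ℝ) :
    (collocation (fun j y => c j * f j y) x).det = (∏ j, c j) * (collocation f x).det :=
  Matrix.det_mul_row c (collocation f x)

theorem det_collocation_mul {n : ℕ} (w : ℝ → ℝ) (f : Fin n → ℝ → ℝ) (x : Fin n → ℝ) :
    (collocation (fun j y => w y * f j y) x).det = (∏ i, w (x i)) * (collocation f x).det :=
  Matrix.det_mul_column (fun i => w (x i)) (collocation f x)

theorem hasDerivAt_exp_const_mul (c y : ℝ) :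
    HasDerivAt (fun y : ℝ => Real.exp (c * y)) (c * Real.exp (c * y)) y := by
  simpa [mul_comm] using ((hasDerivAt_id y).const_mul c).exp

/-- Total positivity of the exponential kernel, in quantitative form: for increasing exponents the
determinant dominates a positive multiple of the Vandermonde determinant of the nodes. -/
theorem exists_vandermonde_le_det_exp {n : ℕ} {y : Fin n → ℝ} (hy : StrictMono y) :
    ∃ c > (0 : ℝ), ∀ x : Fin n → ℝ, Monotone x → (∀ i, x i ∈ Set.Icc (0 : ℝ) 1) →
      c * (Matrix.vandermonde x).det ≤ (collocation (fun j t => Real.exp (y j * t)) x).det := by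
  induction n with
  | zero => exact ⟨1, one_pos, fun x _ _ => by simp⟩
  | succ n ih =>
    -- Dividing by the first exponential shifts the exponents and makes the first column constant.
    let z : Fin n → ℝ := fun j => y j.succ - y 0
    have hz0 : ∀ j, 0 < z j := fun j => sub_pos.2 (hy (Fin.succ_pos j))
    obtain ⟨c, hc, h⟩ := ih (y := z) fun i j hij =>
      sub_lt_sub_right (hy (Fin.succ_lt_succ_iff.2 hij)) _
    have hP : 0 < ∏ j, z j := Finset.prod_pos fun j _ => hz0 j
    have hQ : 0 < ∏ j : Fin n, (((j : ℕ) : ℝ) + 1)⁻¹ := Finset.prod_pos fun j _ => by positivity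
    let E := Real.exp (-|y 0|) ^ (n + 1)
    have hE : 0 < E := by positivity
    refine ⟨E * ((∏ j, z j) * c * ∏ j : Fin n, (((j : ℕ) : ℝ) + 1)⁻¹), by positivity,
      fun x hx hxm => ?_⟩
    have hV := vandermonde_nonneg_of_monotone hx
    have key := det_collocation_cons_one_le (α := 0) (β := 1) (a := (∏ j, z j) * c) (b := 1)
      (fun j t => hasDerivAt_monomial j t) (fun j t => hasDerivAt_exp_const_mul (z j) t)
      (fun ξ hξ hξm => by
        rw [det_collocation_const_mul z fun j t => Real.exp (z j * t), one_mul, mul_assoc]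
        exact mul_le_mul_of_nonneg_left (h ξ hξ hξm) hP.le) hx hxm
    rw [det_collocation_cons_one_monomials, one_mul, ← mul_assoc] at key
    have e : (fun (j : Fin (n + 1)) t => Real.exp (y j * t)) = fun j t => Real.exp (y 0 * t) *
        (Fin.cons (α := fun _ => ℝ → ℝ) (fun _ => 1)
          fun (j : Fin n) t => Real.exp (z j * t)) j t := by
      ext j t
      refine Fin.cases ?_ (fun j => ?_) j
      · simp
      · simp only [Fin.cons_succ, z]; rw [← Real.exp_add]; congr 1; ring
    rw [e, det_collocation_mul fun t => Real.exp (y 0 * t), mul_assoc]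
    have hE' : E ≤ ∏ i, Real.exp (y 0 * x i) := by
      have : E = ∏ _i : Fin (n + 1), Real.exp (-|y 0|) := by simp [E]
      rw [this]
      refine Finset.prod_le_prod (fun i _ => (Real.exp_pos _).le) fun i _ => Real.exp_le_exp.2 ?_
      have h1 := hxm i
      have h2 := neg_abs_le (y 0)
      nlinarith [h1.1, h1.2, abs_nonneg (y 0)]
    refine mul_le_mul hE' key (by positivity) (hE.le.trans hE')

/-- Upper bound: a collocation determinant of exponentials and one smooth function is at most a
multiple of the Vandermonde determinant of the nodes. -/
theorem exists_det_exp_snoc_le_vandermonde {n : ℕ} (y : Fin n → ℝ) {f : ℝ → ℝ}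
    (hf : ContDiff ℝ (⊤ : ℕ∞) f) :
    ∃ C > (0 : ℝ), ∀ x : Fin (n + 1) → ℝ, Monotone x → (∀ i, x i ∈ Set.Icc (0 : ℝ) 1) →
      |(collocation (Fin.snoc (α := fun _ => ℝ → ℝ) (fun j t => Real.exp (y j * t)) f) x).det| ≤
        C * (Matrix.vandermonde x).det := by
  induction n generalizing f with
  | zero =>
    obtain ⟨C, hC⟩ := isCompact_Icc.exists_bound_of_continuousOn (s := Set.Icc (0 : ℝ) 1)
      hf.continuous.continuousOn
    refine ⟨max C 1, by positivity, fun x _ hxm => ?_⟩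
    have h := hC (x 0) (hxm 0)
    rw [Real.norm_eq_abs] at h
    simpa [collocation, Fin.snoc] using Or.inl h
  | succ n ih =>
    -- Division by the first exponential; the last function stays smooth.
    let z : Fin n → ℝ := fun j => y j.succ - y 0
    let g : ℝ → ℝ := fun t => Real.exp (-y 0 * t) * f t
    have hg : ContDiff ℝ (⊤ : ℕ∞) g := by
      have : ContDiff ℝ (⊤ : ℕ∞) fun t : ℝ => Real.exp (-y 0 * t) := by fun_prop
      exact this.mul hf
    obtain ⟨hg1, hg2⟩ := contDiff_infty_iff_deriv.1 hg
    obtain ⟨C, hC, h⟩ := ih z hg2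
    let u : Fin (n + 1) → ℝ → ℝ :=
      Fin.snoc (α := fun _ => ℝ → ℝ) (fun j t => Real.exp (z j * t)) g
    let u' : Fin (n + 1) → ℝ → ℝ := fun j t => Fin.snoc (α := fun _ => ℝ) z 1 j *
      Fin.snoc (α := fun _ => ℝ → ℝ) (fun j t => Real.exp (z j * t)) (deriv g) j t
    have hu : ∀ j t, HasDerivAt (u j) (u' j t) t := by
      intro j t
      refine Fin.lastCases ?_ (fun j => ?_) j
      · simpa [u, u'] using (hg1 t).hasDerivAt
      · simpa [u, u'] using hasDerivAt_exp_const_mul (z j) t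
    set Z := |∏ j, Fin.snoc (α := fun _ => ℝ) z 1 j| with hZ
    have hQ : 0 < ∏ j : Fin (n + 1), (((j : ℕ) : ℝ) + 1)⁻¹ :=
      Finset.prod_pos fun j _ => by positivity
    have hu' : ∀ ξ : Fin (n + 1) → ℝ, Monotone ξ → (∀ i, ξ i ∈ Set.Icc (0 : ℝ) 1) →
        |(collocation u' ξ).det| ≤ (Z * C) *
          (collocation (fun (j : Fin (n + 1)) t => t ^ (j : ℕ)) ξ).det := by
      intro ξ hξ hξm
      rw [det_collocation_const_mul, abs_mul, ← det_vandermonde_eq_collocation, mul_assoc]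
      exact mul_le_mul_of_nonneg_left (h ξ hξ hξm) (abs_nonneg _)
    let E := Real.exp |y 0| ^ (n + 1 + 1)
    refine ⟨E * ((Z * C + 1) * ∏ j : Fin (n + 1), (((j : ℕ) : ℝ) + 1)⁻¹), by positivity,
      fun x hx hxm => ?_⟩
    have hV := vandermonde_nonneg_of_monotone hx
    have key1 := det_collocation_cons_one_le (α := 0) (β := 1) (a := 1) (b := Z * C) hu
      (fun j t => hasDerivAt_monomial j t)
      (fun ξ hξ hξm => by
        rw [one_mul]; exact (le_abs_self _).trans (hu' ξ hξ hξm)) hx hxm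
    have key2 := det_collocation_cons_one_le (α := 0) (β := 1) (a := -1) (b := Z * C) hu
      (fun j t => hasDerivAt_monomial j t)
      (fun ξ hξ hξm => by
        rw [neg_one_mul]; exact (neg_le_abs _).trans (hu' ξ hξ hξm)) hx hxm
    rw [det_collocation_cons_one_monomials, ← mul_assoc] at key1 key2
    have key : |(collocation (Fin.cons (α := fun _ => ℝ → ℝ) (fun _ => 1) u) x).det| ≤
        (Z * C + 1) * (∏ j : Fin (n + 1), (((j : ℕ) : ℝ) + 1)⁻¹) *
          (Matrix.vandermonde x).det := by
      rw [abs_le']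
      have : 0 ≤ (∏ j : Fin (n + 1), (((j : ℕ) : ℝ) + 1)⁻¹) * (Matrix.vandermonde x).det := by
        positivity
      constructor <;> linarith
    have e : Fin.snoc (α := fun _ => ℝ → ℝ) (fun (j : Fin (n + 1)) t => Real.exp (y j * t)) f =
        fun j t => Real.exp (y 0 * t) *
        (Fin.cons (α := fun _ => ℝ → ℝ) (fun _ => 1) u) j t := by
      ext j t
      refine Fin.cases ?_ (fun j => ?_) j
      · rw [Fin.cons_zero, mul_one, ← Fin.castSucc_zero, Fin.snoc_castSucc]
      · rw [Fin.cons_succ]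
        refine Fin.lastCases ?_ (fun j => ?_) j
        · rw [Fin.succ_last, Fin.snoc_last]
          simp only [u, Fin.snoc_last, g]
          rw [← mul_assoc, ← Real.exp_add]
          simp
        · rw [Fin.succ_castSucc, Fin.snoc_castSucc]
          simp only [u, Fin.snoc_castSucc, z]
          rw [← Real.exp_add]; congr 1; ring
    rw [e, det_collocation_mul fun t => Real.exp (y 0 * t), mul_assoc E, abs_mul]
    have hE' : |∏ i, Real.exp (y 0 * x i)| ≤ E := by
      rw [abs_of_pos (Finset.prod_pos fun i _ => Real.exp_pos _)]
      have : E = ∏ _i : Fin (n + 1 + 1), Real.exp |y 0| := by simp [E]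
      rw [this]
      refine Finset.prod_le_prod (fun i _ => (Real.exp_pos _).le) fun i _ => Real.exp_le_exp.2 ?_
      have h1 := hxm i
      have h2 := le_abs_self (y 0)
      nlinarith [h1.1, h1.2, abs_nonneg (y 0)]
    exact mul_le_mul hE' key (abs_nonneg _) (by positivity)

/-! ### Gaussian windows at nodes in any order -/

theorem det_collocation_comp_perm {n : ℕ} (u : Fin n → ℝ → ℝ) (x : Fin n → ℝ)
    (e : Equiv.Perm (Fin n)) :
    (collocation u (x ∘ e)).det = (Equiv.Perm.sign e : ℤ) * (collocation u x).det := by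
  rw [← Matrix.det_permute]; rfl

theorem sign_mul_sign_real {n : ℕ} (e : Equiv.Perm (Fin n)) :
    (((Equiv.Perm.sign e : ℤˣ) : ℤ) : ℝ) * (((Equiv.Perm.sign e : ℤˣ) : ℤ) : ℝ) = 1 := by
  rcases Int.units_eq_one_or (Equiv.Perm.sign e) with h | h <;> simp [h]

theorem abs_sign_real {n : ℕ} (e : Equiv.Perm (Fin n)) :
    |(((Equiv.Perm.sign e : ℤˣ) : ℤ) : ℝ)| = 1 := by
  rcases Int.units_eq_one_or (Equiv.Perm.sign e) with h | h <;> simp [h]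

/-- The product of two collocation determinants with the same nodes does not depend on the order
of the nodes. -/
theorem det_mul_det_comp_perm {n : ℕ} (u v : Fin n → ℝ → ℝ) (x : Fin n → ℝ)
    (e : Equiv.Perm (Fin n)) :
    (collocation u (x ∘ e)).det * (collocation v (x ∘ e)).det =
      (collocation u x).det * (collocation v x).det := by
  rw [det_collocation_comp_perm, det_collocation_comp_perm]
  linear_combination (collocation u x).det * (collocation v x).det * sign_mul_sign_real e

theorem abs_det_collocation_comp_perm {n : ℕ} (u : Fin n → ℝ → ℝ) (x : Fin n → ℝ)
    (e : Equiv.Perm (Fin n)) : |(collocation u (x ∘ e)).det| = |(collocation u x).det| := by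
  rw [det_collocation_comp_perm, abs_mul, abs_sign_real, one_mul]

theorem gaussianWindow_eq {n : ℕ} (σ : ℝ) (s : Fin n → ℝ) :
    gaussianWindow σ s = fun j x => Real.exp (-x ^ 2 / σ ^ 2) *
      (Real.exp (-(s j) ^ 2 / σ ^ 2) * Real.exp (2 * s j / σ ^ 2 * x)) := by
  ext j x
  rw [gaussianWindow, gaussianFn, ← Real.exp_add, ← Real.exp_add]
  congr 1
  ring

theorem exp_neg_sq_bounds (σ : ℝ) {x : ℝ} (hx : x ∈ Set.Icc (0 : ℝ) 1) :
    Real.exp (-1 / σ ^ 2) ≤ Real.exp (-x ^ 2 / σ ^ 2) ∧ Real.exp (-x ^ 2 / σ ^ 2) ≤ 1 := by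
  constructor
  · apply Real.exp_le_exp.2
    apply div_le_div_of_nonneg_right _ (sq_nonneg σ)
    nlinarith [hx.1, hx.2]
  · rw [Real.exp_le_one_iff]
    exact div_nonpos_of_nonpos_of_nonneg (by nlinarith [hx.1]) (sq_nonneg σ)

/-- Strict total positivity of the Gaussian kernel, in quantitative form and for nodes in any order:
multiplying both sides of `c * V ≤ det` by the Vandermonde determinant `V` makes the inequality
independent of the order. -/
theorem exists_vandermonde_sq_le_gaussian {n : ℕ} {σ : ℝ} (hσ : 0 < σ) {s : Fin n → ℝ}
    (hs : StrictMono s) :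
    ∃ c > (0 : ℝ), ∀ x : Fin n → ℝ, (∀ i, x i ∈ Set.Icc (0 : ℝ) 1) →
      c * (Matrix.vandermonde x).det ^ 2 ≤
        (Matrix.vandermonde x).det * (collocation (gaussianWindow σ s) x).det := by
  obtain ⟨c, hc, h⟩ := exists_vandermonde_le_det_exp (y := fun j => 2 * s j / σ ^ 2)
    fun i j hij => by
      have := hs hij
      show 2 * s i / σ ^ 2 < 2 * s j / σ ^ 2
      gcongr
  let A := ∏ j, Real.exp (-(s j) ^ 2 / σ ^ 2)
  have hA : 0 < A := Finset.prod_pos fun j _ => Real.exp_pos _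
  let E := Real.exp (-1 / σ ^ 2) ^ n
  refine ⟨E * (A * c), by positivity, fun x hxm => ?_⟩
  rw [sq, ← mul_assoc, det_vandermonde_eq_collocation, mul_assoc,
    ← det_mul_det_comp_perm _ _ x (Tuple.sort x), ← det_mul_det_comp_perm _ (gaussianWindow σ s) x
    (Tuple.sort x), ← det_vandermonde_eq_collocation]
  set w := x ∘ Tuple.sort x with hw
  have hwm : ∀ i, w i ∈ Set.Icc (0 : ℝ) 1 := fun i => hxm _
  have hmono : Monotone w := Tuple.monotone_sort x
  have hV := vandermonde_nonneg_of_monotone hmono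
  have key : E * (A * c) * (Matrix.vandermonde w).det ≤
      (collocation (gaussianWindow σ s) w).det := by
    rw [gaussianWindow_eq, det_collocation_mul (fun x => Real.exp (-x ^ 2 / σ ^ 2)),
      det_collocation_const_mul _ fun j x => Real.exp (2 * s j / σ ^ 2 * x), mul_assoc, mul_assoc]
    have hE : E ≤ ∏ i, Real.exp (-(w i) ^ 2 / σ ^ 2) := by
      have : E = ∏ _i : Fin n, Real.exp (-1 / σ ^ 2) := by simp [E]
      rw [this]
      exact Finset.prod_le_prod (fun i _ => (Real.exp_pos _).le)
        fun i _ => (exp_neg_sq_bounds σ (hwm i)).1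
    have hE0 : 0 < E := by positivity
    exact mul_le_mul hE (mul_le_mul_of_nonneg_left (h w hmono hwm) hA.le) (by positivity)
      (hE0.le.trans hE)
  calc _ = (Matrix.vandermonde w).det * (E * (A * c) * (Matrix.vandermonde w).det) := by ring
    _ ≤ _ := mul_le_mul_of_nonneg_left key hV

/-- A collocation determinant of a smooth function and Gaussian windows is at most a multiple of
the Vandermonde determinant of the nodes, uniformly up to coalescing nodes. -/
theorem exists_abs_det_cons_gaussian_le {n : ℕ} {σ : ℝ} (s : Fin n → ℝ) {f : ℝ → ℝ}
    (hf : ContDiff ℝ (⊤ : ℕ∞) f) :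
    ∃ C > (0 : ℝ), ∀ x : Fin (n + 1) → ℝ, (∀ i, x i ∈ Set.Icc (0 : ℝ) 1) →
      |(collocation (Fin.cons (α := fun _ => ℝ → ℝ) f (gaussianWindow σ s)) x).det| ≤
        C * |(Matrix.vandermonde x).det| := by
  let g : ℝ → ℝ := fun x => Real.exp (x ^ 2 / σ ^ 2) * f x
  have hg : ContDiff ℝ (⊤ : ℕ∞) g := by
    have : ContDiff ℝ (⊤ : ℕ∞) fun x : ℝ => Real.exp (x ^ 2 / σ ^ 2) := by fun_prop
    exact this.mul hf
  obtain ⟨C, hC, h⟩ := exists_det_exp_snoc_le_vandermonde (fun j => 2 * s j / σ ^ 2) hg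
  let A := ∏ j, Fin.snoc (α := fun _ => ℝ) (fun j => Real.exp (-(s j) ^ 2 / σ ^ 2)) 1 j
  refine ⟨|A| * C + 1, by positivity, fun x hxm => ?_⟩
  rw [← abs_det_collocation_comp_perm _ x (Tuple.sort x), det_vandermonde_eq_collocation,
    ← abs_det_collocation_comp_perm _ x (Tuple.sort x), ← det_vandermonde_eq_collocation]
  set w := x ∘ Tuple.sort x with hw
  have hwm : ∀ i, w i ∈ Set.Icc (0 : ℝ) 1 := fun i => hxm _
  have hmono : Monotone w := Tuple.monotone_sort x
  have hV := vandermonde_nonneg_of_monotone hmono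
  have e : Fin.snoc (α := fun _ => ℝ → ℝ) (gaussianWindow σ s) f = fun j x =>
      Real.exp (-x ^ 2 / σ ^ 2) *
      (Fin.snoc (α := fun _ => ℝ) (fun j => Real.exp (-(s j) ^ 2 / σ ^ 2)) 1 j *
        Fin.snoc (α := fun _ => ℝ → ℝ) (fun j t => Real.exp (2 * s j / σ ^ 2 * t)) g j x) := by
    ext j x
    refine Fin.lastCases ?_ (fun j => ?_) j
    · simp only [Fin.snoc_last, g, one_mul]
      rw [← mul_assoc, ← Real.exp_add, neg_div, neg_add_cancel, Real.exp_zero, one_mul]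
    · rw [gaussianWindow_eq]
      simp only [Fin.snoc_castSucc]
  have key : |(collocation (Fin.snoc (α := fun _ => ℝ → ℝ) (gaussianWindow σ s) f) w).det| ≤
      (|A| * C + 1) * (Matrix.vandermonde w).det := by
    rw [e, det_collocation_mul (fun x => Real.exp (-x ^ 2 / σ ^ 2)),
      det_collocation_const_mul, abs_mul, abs_mul]
    have hE : |∏ i, Real.exp (-(w i) ^ 2 / σ ^ 2)| ≤ 1 := by
      rw [abs_of_pos (Finset.prod_pos fun i _ => Real.exp_pos _)]
      exact Finset.prod_le_one (fun i _ => (Real.exp_pos _).le)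
        fun i _ => (exp_neg_sq_bounds σ (hwm i)).2
    have h2 := mul_le_mul_of_nonneg_left (h w hmono hwm) (abs_nonneg A)
    have h3 := mul_le_of_le_one_left (b := |A| * |(collocation (Fin.snoc (α := fun _ => ℝ → ℝ)
      (fun j t => Real.exp (2 * s j / σ ^ 2 * t)) g) w).det|) (by positivity) hE
    linarith
  have hrot : collocation (Fin.snoc (α := fun _ => ℝ → ℝ) (gaussianWindow σ s) f) w =
      (collocation (Fin.cons (α := fun _ => ℝ → ℝ) f (gaussianWindow σ s)) w).submatrix id
        (finRotate (n + 1)) := by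
    rw [Fin.snoc_eq_cons_rotate]; rfl
  rw [hrot, Matrix.det_permute', abs_mul, abs_sign_real, one_mul] at key
  rwa [abs_of_nonneg hV]

/-! ### Interleaved pairs of nodes -/

/-- The family `p_0, q_0, p_1, q_1, …`. -/
def interleave {α : Type*} {k : ℕ} (p q : Fin k → α) : Fin (2 * k) → α := fun r =>
  if (r : ℕ) % 2 = 0 then p ⟨r / 2, by omega⟩ else q ⟨r / 2, by omega⟩

/-- The position of `p_i` in `interleave p q`. -/
def evenIdx {k : ℕ} (i : Fin k) : Fin (2 * k) := ⟨2 * i, by omega⟩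

/-- The position of `q_i` in `interleave p q`. -/
def oddIdx {k : ℕ} (i : Fin k) : Fin (2 * k) := ⟨2 * i + 1, by omega⟩

@[simp] theorem interleave_evenIdx {α : Type*} {k : ℕ} (p q : Fin k → α) (i : Fin k) :
    interleave p q (evenIdx i) = p i := by
  simp [interleave, evenIdx]

@[simp] theorem interleave_oddIdx {α : Type*} {k : ℕ} (p q : Fin k → α) (i : Fin k) :
    interleave p q (oddIdx i) = q i := by
  have h : (2 * (i : ℕ) + 1) % 2 ≠ 0 := by omega
  have h2 : (2 * (i : ℕ) + 1) / 2 = i := by omega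
  simp [interleave, oddIdx, h2]

theorem eq_evenIdx_or_oddIdx {k : ℕ} (r : Fin (2 * k)) :
    (∃ i, r = evenIdx i) ∨ ∃ i, r = oddIdx i := by
  rcases Nat.even_or_odd' (r : ℕ) with ⟨i, hi | hi⟩
  · exact Or.inl ⟨⟨i, by omega⟩, Fin.ext hi⟩
  · exact Or.inr ⟨⟨i, by omega⟩, Fin.ext hi⟩

theorem evenIdx_ne_oddIdx {k : ℕ} (i j : Fin k) : evenIdx i ≠ oddIdx j := by
  intro h
  have := congrArg Fin.val h
  simp only [evenIdx, oddIdx] at this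
  omega

theorem evenIdx_injective {k : ℕ} : Function.Injective (evenIdx : Fin k → Fin (2 * k)) := by
  intro i j h
  have := congrArg Fin.val h
  simp only [evenIdx] at this
  exact Fin.ext (by omega)

theorem oddIdx_injective {k : ℕ} : Function.Injective (oddIdx : Fin k → Fin (2 * k)) := by
  intro i j h
  have := congrArg Fin.val h
  simp only [oddIdx] at this
  exact Fin.ext (by omega)

theorem prod_interleaved {k : ℕ} (f : Fin (2 * k) → ℝ) :
    ∏ r, f r = ∏ i : Fin k, f (evenIdx i) * f (oddIdx i) := by
  have hb : Function.Bijective (Sum.elim evenIdx oddIdx : Fin k ⊕ Fin k → Fin (2 * k)) := by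
    constructor
    · rintro (i | i) (j | j) h
      · exact congrArg Sum.inl (evenIdx_injective h)
      · exact absurd h (evenIdx_ne_oddIdx i j)
      · exact absurd h.symm (evenIdx_ne_oddIdx j i)
      · exact congrArg Sum.inr (oddIdx_injective h)
    · intro r
      rcases eq_evenIdx_or_oddIdx r with ⟨i, rfl⟩ | ⟨i, rfl⟩
      · exact ⟨Sum.inl i, rfl⟩
      · exact ⟨Sum.inr i, rfl⟩
  rw [← Fintype.prod_bijective _ hb (fun a => f (Sum.elim evenIdx oddIdx a)) f fun _ => rfl,
    Fintype.prod_sum_type, Finset.prod_mul_distrib]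
  rfl

/-- If each row at an odd position of a family of pairs of rows is the even row plus `c i` times a
new row, then replacing the odd rows by the new ones divides the determinant by `∏ i, c i`. -/
theorem det_eq_prod_mul_det_of_pairs {n k : ℕ} (A A' : Matrix (Fin n) (Fin n) ℝ)
    (ι : Fin (2 * k) → Fin n) (hι : Function.Injective ι) (c : Fin k → ℝ)
    (hoff : ∀ r, (∀ i, r ≠ ι (oddIdx i)) → A r = A' r)
    (hodd : ∀ i, A (ι (oddIdx i)) = A' (ι (evenIdx i)) + c i • A' (ι (oddIdx i))) :
    A.det = (∏ i, c i) * A'.det := by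
  classical
  -- The odd rows are replaced one at a time.
  let B : Finset (Fin k) → Matrix (Fin n) (Fin n) ℝ := fun S r =>
    if ∃ i ∈ S, r = ι (oddIdx i) then A' r else A r
  have main : ∀ S : Finset (Fin k), A.det = (∏ i ∈ S, c i) * (B S).det := by
    intro S
    induction S using Finset.induction_on with
    | empty =>
      have : B ∅ = A := by ext r j; simp [B]
      rw [this]; simp
    | insert a S ha ih =>
      have h1 : B S = (B (insert a S)).updateRow (ι (oddIdx a)) (A (ι (oddIdx a))) := by
        funext r
        by_cases hr : r = ι (oddIdx a)
        · subst hr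
          rw [Matrix.updateRow_self]
          have : ¬ ∃ i ∈ S, ι (oddIdx a) = ι (oddIdx i) := by
            rintro ⟨i, hi, h⟩
            exact ha (oddIdx_injective (hι h) ▸ hi)
          simp only [B, this, if_false]
        · rw [Matrix.updateRow_ne hr]
          simp [B, hr]
      have h2 : B (insert a S) (ι (evenIdx a)) = A' (ι (evenIdx a)) := by
        have h3 : ∀ i, ι (evenIdx a) ≠ ι (oddIdx i) :=
          fun i h => evenIdx_ne_oddIdx a i (hι h)
        simp only [B]
        split_ifs
        · rfl
        · exact hoff _ h3
      have h4 : B (insert a S) (ι (oddIdx a)) = A' (ι (oddIdx a)) := by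
        simp [B]
      rw [ih, Finset.prod_insert ha, h1, hodd, Matrix.det_updateRow_add,
        Matrix.det_updateRow_smul, ← h2, ← h4, Matrix.updateRow_eq_self,
        Matrix.det_zero_of_row_eq (i := ι (oddIdx a)) (j := ι (evenIdx a))
          (fun h => evenIdx_ne_oddIdx a a (hι h).symm)]
      · ring
      · rw [Matrix.updateRow_self, Matrix.updateRow_ne]
        exact fun h => evenIdx_ne_oddIdx a a (hι h)
  rw [main Finset.univ]
  congr 2
  funext r
  by_cases hr : ∃ i, r = ι (oddIdx i)
  · simp [B, hr]
  · simp only [B, Finset.mem_univ, true_and, hr, if_false]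
    exact hoff r fun i h => hr ⟨i, h⟩

/-! ### Divided differences and determinants with confluent pairs -/

/-- The divided difference `(f q - f p) / (q - p)`, written as an integral so that it is jointly
continuous and equals `f' p` for `q = p`. -/
noncomputable def divDiff (f : ℝ → ℝ) (p q : ℝ) : ℝ := ∫ v in (0 : ℝ)..1, deriv f (p + v * (q - p))

theorem divDiff_self (f : ℝ → ℝ) (p : ℝ) : divDiff f p p = deriv f p := by
  simp [divDiff]

theorem continuous_divDiff {f : ℝ → ℝ} (hf : Continuous (deriv f)) :
    Continuous fun x : ℝ × ℝ => divDiff f x.1 x.2 := by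
  apply intervalIntegral.continuous_parametric_intervalIntegral_of_continuous'
  simp only [Function.uncurry_def]
  fun_prop

theorem mul_divDiff {f : ℝ → ℝ} (hd : Differentiable ℝ f) (hf : Continuous (deriv f)) (p q : ℝ) :
    (q - p) * divDiff f p q = f q - f p := by
  have h : ∀ v ∈ Set.uIcc (0 : ℝ) 1, HasDerivAt (fun v => f (p + v * (q - p)))
      ((q - p) * deriv f (p + v * (q - p))) v := by
    intro v _
    have h1 : HasDerivAt (fun v : ℝ => p + v * (q - p)) (q - p) v := by
      simpa using ((hasDerivAt_id v).mul_const (q - p)).const_add p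
    have := (hd (p + v * (q - p))).hasDerivAt.comp v h1
    rwa [mul_comm] at this
  have := intervalIntegral.integral_eq_sub_of_hasDerivAt h
    (Continuous.intervalIntegrable (by fun_prop) _ _)
  rw [intervalIntegral.integral_const_mul] at this
  simpa [divDiff] using this

/-- The row `(u_j a)_j`. -/
def valueRow {n : ℕ} (u : Fin n → ℝ → ℝ) (a : ℝ) : Fin n → ℝ := fun j => u j a

/-- The row of divided differences `(u_j[a, b])_j`. -/
noncomputable def divDiffRow {n : ℕ} (u : Fin n → ℝ → ℝ) (a b : ℝ) : Fin n → ℝ :=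
  fun j => divDiff (u j) a b

/-- For each pair of points `p_i, q_i`, the row of values at `p_i` and the row of divided
differences. At `p = q = t` these are values and derivatives. -/
noncomputable def pairRows {n k : ℕ} (u : Fin n → ℝ → ℝ) (p q : Fin k → ℝ) :
    Fin (2 * k) → Fin n → ℝ :=
  interleave (fun i => valueRow u (p i)) (fun i => divDiffRow u (p i) (q i))

/-- The determinant with one row `A`, followed by the rows of the pairs. -/
noncomputable def pairDet₁ {k : ℕ} (u : Fin (2 * k + 1) → ℝ → ℝ) (A : Fin (2 * k + 1) → ℝ)
    (p q : Fin k → ℝ) : ℝ :=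
  (Matrix.of (Fin.cons (α := fun _ => Fin (2 * k + 1) → ℝ) A (pairRows u p q))).det

/-- The determinant with two rows `A`, `B`, followed by the rows of the pairs. -/
noncomputable def pairDet₂ {k : ℕ} (u : Fin (2 * k + 2) → ℝ → ℝ) (A B : Fin (2 * k + 2) → ℝ)
    (p q : Fin k → ℝ) : ℝ :=
  (Matrix.of (Fin.cons (α := fun _ => Fin (2 * k + 2) → ℝ) A
    (Fin.cons (α := fun _ => Fin (2 * k + 2) → ℝ) B (pairRows u p q) :
      Fin (2 * k + 1) → Fin (2 * k + 2) → ℝ))).det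

/-- The nodes `a, p_0, q_0, p_1, q_1, …`. -/
def nodes₁ {k : ℕ} (a : ℝ) (p q : Fin k → ℝ) : Fin (2 * k + 1) → ℝ :=
  Fin.cons (α := fun _ => ℝ) a (interleave p q)

/-- The nodes `a, b, p_0, q_0, p_1, q_1, …`. -/
def nodes₂ {k : ℕ} (a b : ℝ) (p q : Fin k → ℝ) : Fin (2 * k + 2) → ℝ :=
  Fin.cons (α := fun _ => ℝ) a (nodes₁ b p q)

/-- The nodes `x, a, b, p_0, q_0, p_1, q_1, …`. -/
def nodes₃ {k : ℕ} (x a b : ℝ) (p q : Fin k → ℝ) : Fin (2 * k + 2 + 1) → ℝ :=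
  Fin.cons (α := fun _ => ℝ) x (nodes₂ a b p q)

/-- The product of the distances within the pairs. -/
def gapProd {k : ℕ} (p q : Fin k → ℝ) : ℝ := ∏ i, (q i - p i)

theorem det_collocation_nodes₁ {k : ℕ} {u : Fin (2 * k + 1) → ℝ → ℝ}
    (hd : ∀ j, Differentiable ℝ (u j)) (hc : ∀ j, Continuous (deriv (u j))) (a : ℝ)
    (p q : Fin k → ℝ) :
    (collocation u (nodes₁ a p q)).det = gapProd p q * pairDet₁ u (valueRow u a) p q := by
  apply det_eq_prod_mul_det_of_pairs _ _ Fin.succ (Fin.succ_injective _)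
  · intro r
    refine Fin.cases (fun _ => rfl) (fun r h => ?_) r
    rcases eq_evenIdx_or_oddIdx r with ⟨i, rfl⟩ | ⟨i, rfl⟩
    swap
    · exact absurd rfl (h i)
    ext j
    simp [collocation, nodes₁, pairRows, valueRow]
  · intro i
    ext j
    simp [collocation, nodes₁, pairRows, valueRow, divDiffRow, mul_divDiff (hd j) (hc j)]

theorem det_collocation_nodes₂ {k : ℕ} {u : Fin (2 * k + 2) → ℝ → ℝ}
    (hd : ∀ j, Differentiable ℝ (u j)) (hc : ∀ j, Continuous (deriv (u j))) (a b : ℝ)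
    (p q : Fin k → ℝ) :
    (collocation u (nodes₂ a b p q)).det =
      gapProd p q * pairDet₂ u (valueRow u a) (valueRow u b) p q := by
  apply det_eq_prod_mul_det_of_pairs _ _ (fun r => Fin.succ (Fin.succ r))
    ((Fin.succ_injective _).comp (Fin.succ_injective _))
  · intro r
    refine Fin.cases (fun _ => rfl) (fun r => ?_) r
    refine Fin.cases (fun _ => rfl) (fun r h => ?_) r
    rcases eq_evenIdx_or_oddIdx r with ⟨i, rfl⟩ | ⟨i, rfl⟩
    swap
    · exact absurd rfl (h i)
    ext j
    simp [collocation, nodes₂, nodes₁, pairRows, valueRow]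
  · intro i
    ext j
    simp [collocation, nodes₂, nodes₁, pairRows, valueRow, divDiffRow, mul_divDiff (hd j) (hc j)]

theorem continuous_pairRows {X : Type*} [TopologicalSpace X] {n k : ℕ} {u : Fin n → ℝ → ℝ}
    (hd : ∀ j, Differentiable ℝ (u j)) (hc : ∀ j, Continuous (deriv (u j)))
    {p q : X → Fin k → ℝ} (hp : Continuous p) (hq : Continuous q) (r : Fin (2 * k)) (j : Fin n) :
    Continuous fun x => pairRows u (p x) (q x) r j := by
  rcases eq_evenIdx_or_oddIdx r with ⟨i, rfl⟩ | ⟨i, rfl⟩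
  · simp only [pairRows, interleave_evenIdx, valueRow]
    exact (hd j).continuous.comp ((continuous_apply i).comp hp)
  · simp only [pairRows, interleave_oddIdx, divDiffRow]
    exact (continuous_divDiff (hc j)).comp
      (((continuous_apply i).comp hp).prodMk ((continuous_apply i).comp hq))

theorem continuous_pairDet₁ {X : Type*} [TopologicalSpace X] {k : ℕ}
    {u : Fin (2 * k + 1) → ℝ → ℝ}
    (hd : ∀ j, Differentiable ℝ (u j)) (hc : ∀ j, Continuous (deriv (u j)))
    {A : X → Fin (2 * k + 1) → ℝ} (hA : Continuous A)
    {p q : X → Fin k → ℝ} (hp : Continuous p) (hq : Continuous q) :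
    Continuous fun x => pairDet₁ u (A x) (p x) (q x) := by
  apply Continuous.matrix_det
  refine continuous_matrix fun r j => ?_
  refine Fin.cases ?_ (fun r => ?_) r
  · exact (continuous_apply j).comp hA
  · exact continuous_pairRows hd hc hp hq r j

theorem continuous_pairDet₂ {X : Type*} [TopologicalSpace X] {k : ℕ}
    {u : Fin (2 * k + 2) → ℝ → ℝ}
    (hd : ∀ j, Differentiable ℝ (u j)) (hc : ∀ j, Continuous (deriv (u j)))
    {A B : X → Fin (2 * k + 2) → ℝ} (hA : Continuous A) (hB : Continuous B)
    {p q : X → Fin k → ℝ} (hp : Continuous p) (hq : Continuous q) :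
    Continuous fun x => pairDet₂ u (A x) (B x) (p x) (q x) := by
  apply Continuous.matrix_det
  refine continuous_matrix fun r j => ?_
  refine Fin.cases ?_ (fun r => ?_) r
  · exact (continuous_apply j).comp hA
  refine Fin.cases ?_ (fun r => ?_) r
  · exact (continuous_apply j).comp hB
  · exact continuous_pairRows hd hc hp hq r j

theorem pairDet₂_self {k : ℕ} (u : Fin (2 * k + 2) → ℝ → ℝ) (A : Fin (2 * k + 2) → ℝ)
    (p q : Fin k → ℝ) : pairDet₂ u A A p q = 0 :=
  Matrix.det_zero_of_row_eq (i := 0) (j := 1) (by simp) rfl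

theorem pairDet₂_add_smul {k : ℕ} (u : Fin (2 * k + 2) → ℝ → ℝ) (A B B' : Fin (2 * k + 2) → ℝ)
    (c : ℝ) (p q : Fin k → ℝ) :
    pairDet₂ u A (B + c • B') p q = pairDet₂ u A B p q + c * pairDet₂ u A B' p q := by
  have h : ∀ D : Fin (2 * k + 2) → ℝ, pairDet₂ u A D p q =
      ((Matrix.of (Fin.cons (α := fun _ => Fin (2 * k + 2) → ℝ) A
        (Fin.cons (α := fun _ => Fin (2 * k + 2) → ℝ) B (pairRows u p q) :
          Fin (2 * k + 1) → Fin (2 * k + 2) → ℝ))).updateRow 1 D).det := by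
    intro D
    unfold pairDet₂
    congr 1
    funext r
    refine Fin.cases ?_ (fun r => ?_) r
    · rw [Matrix.updateRow_ne (by simp)]; rfl
    refine Fin.cases ?_ (fun r => ?_) r
    · exact (Matrix.updateRow_self (i := (1 : Fin (2 * k + 2)))).symm
    · rw [Matrix.updateRow_ne]
      · rfl
      · intro h
        have := congrArg Fin.val h
        simp at this
  rw [h, h B, h B', Matrix.det_updateRow_add, Matrix.det_updateRow_smul]

theorem valueRow_eq_add_smul {n : ℕ} {u : Fin n → ℝ → ℝ}
    (hd : ∀ j, Differentiable ℝ (u j)) (hc : ∀ j, Continuous (deriv (u j))) (a b : ℝ) :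
    valueRow u b = valueRow u a + (b - a) • divDiffRow u a b := by
  ext j
  simp [valueRow, divDiffRow, mul_divDiff (hd j) (hc j)]

/-! ### Vandermonde determinants of nodes near the support points -/

theorem det_vandermonde_cons {n : ℕ} (a : ℝ) (v : Fin n → ℝ) :
    (Matrix.vandermonde (Fin.cons (α := fun _ => ℝ) a v)).det =
      (∏ j, (v j - a)) * (Matrix.vandermonde v).det := by
  rw [Matrix.det_vandermonde, Fin.prod_univ_succ, Fin.prod_Ioi_zero, Matrix.det_vandermonde]
  simp only [Fin.prod_Ioi_succ, Fin.cons_zero, Fin.cons_succ]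

theorem det_snoc {n : ℕ} (v : Fin n → Fin (n + 1) → ℝ) (a : Fin (n + 1) → ℝ) :
    (Matrix.of (Fin.snoc (α := fun _ => Fin (n + 1) → ℝ) v a)).det =
      (-1) ^ n * (Matrix.of (Fin.cons (α := fun _ => Fin (n + 1) → ℝ) a v)).det := by
  have h := Matrix.det_permute (finRotate (n + 1))
    (Matrix.of (Fin.cons (α := fun _ => Fin (n + 1) → ℝ) a v))
  rw [sign_finRotate] at h
  push_cast at h
  rw [← h, Fin.snoc_eq_cons_rotate]
  rfl

/-- The points `t_i` are at distance at least `3 d` from each other and from `0` and `1`. -/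
structure IsSeparated {k : ℕ} (t : Fin k → ℝ) (d : ℝ) : Prop where
  pos : 0 < d
  two_mul_le : 2 * d ≤ 1
  sep : ∀ i j, i < j → t i + 3 * d ≤ t j
  left : ∀ i, 3 * d ≤ t i
  right : ∀ i, t i + 3 * d ≤ 1

/-- A pair `p_i < q_i` of points within distance `d` of each `t_i`. -/
structure IsNear {k : ℕ} (t : Fin k → ℝ) (d : ℝ) (p q : Fin k → ℝ) : Prop where
  lt : ∀ i, p i < q i
  left : ∀ i, |p i - t i| ≤ d
  right : ∀ i, |q i - t i| ≤ d

/-- The product of the differences of all the points of the pairs with `a`. -/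
def pairProd {k : ℕ} (p q : Fin k → ℝ) (a : ℝ) : ℝ := ∏ i, (p i - a) * (q i - a)

theorem prod_interleave_sub {k : ℕ} (p q : Fin k → ℝ) (a : ℝ) :
    ∏ r, (interleave p q r - a) = pairProd p q a := by
  rw [prod_interleaved]
  simp [pairProd]

theorem vandermonde_nodes₁ {k : ℕ} (a : ℝ) (p q : Fin k → ℝ) :
    (Matrix.vandermonde (nodes₁ a p q)).det =
      pairProd p q a * (Matrix.vandermonde (interleave p q)).det := by
  rw [nodes₁, det_vandermonde_cons, prod_interleave_sub]

theorem vandermonde_nodes₂ {k : ℕ} (a b : ℝ) (p q : Fin k → ℝ) :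
    (Matrix.vandermonde (nodes₂ a b p q)).det = (b - a) * pairProd p q a *
      (pairProd p q b * (Matrix.vandermonde (interleave p q)).det) := by
  rw [nodes₂, det_vandermonde_cons, vandermonde_nodes₁, Fin.prod_univ_succ]
  simp only [nodes₁, Fin.cons_zero, Fin.cons_succ, prod_interleave_sub]

theorem vandermonde_nodes₃ {k : ℕ} (x a b : ℝ) (p q : Fin k → ℝ) :
    (Matrix.vandermonde (nodes₃ x a b p q)).det = (a - x) * ((b - x) * pairProd p q x) *
      ((b - a) * pairProd p q a *
        (pairProd p q b * (Matrix.vandermonde (interleave p q)).det)) := by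
  rw [nodes₃, det_vandermonde_cons, vandermonde_nodes₂, Fin.prod_univ_succ, Fin.prod_univ_succ]
  simp only [nodes₂, nodes₁, Fin.cons_zero, Fin.cons_succ, prod_interleave_sub]

theorem pairProd_pos {k : ℕ} {p q : Fin k → ℝ} {a : ℝ} (h : ∀ i, 0 < (p i - a) * (q i - a)) :
    0 < pairProd p q a := Finset.prod_pos fun i _ => h i

section bounds

variable {k : ℕ} {t p q : Fin k → ℝ} {d : ℝ}

theorem IsNear.sq_le_mul (hn : IsNear t d p q) (hd : 0 < d) {a : ℝ}
    (ha : ∀ i, 2 * d ≤ |a - t i|) (i : Fin k) : d ^ 2 ≤ (p i - a) * (q i - a) := by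
  have h1 := abs_le.1 (hn.left i)
  have h2 := abs_le.1 (hn.right i)
  rcases le_abs.1 (ha i) with h | h
  · nlinarith
  · nlinarith

theorem IsNear.pow_le_pairProd (hn : IsNear t d p q) (hd : 0 < d) {a : ℝ}
    (ha : ∀ i, 2 * d ≤ |a - t i|) : (d ^ 2) ^ k ≤ pairProd p q a := by
  have : (d ^ 2) ^ k = ∏ _i : Fin k, d ^ 2 := by simp
  rw [this]
  exact Finset.prod_le_prod (fun i _ => by positivity) fun i _ => hn.sq_le_mul hd ha i

theorem IsSeparated.zero_far (hs : IsSeparated t d) (i : Fin k) : 2 * d ≤ |0 - t i| := by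
  have := hs.left i; have := hs.pos
  rw [zero_sub, abs_neg, abs_of_nonneg (by linarith)]; linarith

theorem IsSeparated.one_far (hs : IsSeparated t d) (i : Fin k) : 2 * d ≤ |1 - t i| := by
  have := hs.right i; have := hs.pos
  rw [abs_of_nonneg (by linarith)]; linarith

theorem IsNear.mem_Icc (hn : IsNear t d p q) (hs : IsSeparated t d) (i : Fin k) :
    p i ∈ Set.Icc (0 : ℝ) 1 ∧ q i ∈ Set.Icc (0 : ℝ) 1 := by
  have h1 := abs_le.1 (hn.left i)
  have h2 := abs_le.1 (hn.right i)
  have := hs.left i; have := hs.right i; have := hs.pos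
  constructor <;> constructor <;> linarith

theorem IsNear.interleave_mem_Icc (hn : IsNear t d p q) (hs : IsSeparated t d) (r : Fin (2 * k)) :
    interleave p q r ∈ Set.Icc (0 : ℝ) 1 := by
  rcases eq_evenIdx_or_oddIdx r with ⟨i, rfl⟩ | ⟨i, rfl⟩
  · simpa using (hn.mem_Icc hs i).1
  · simpa using (hn.mem_Icc hs i).2

theorem IsNear.nodes₁_mem_Icc (hn : IsNear t d p q) (hs : IsSeparated t d) {a : ℝ}
    (ha : a ∈ Set.Icc (0 : ℝ) 1) (r : Fin (2 * k + 1)) : nodes₁ a p q r ∈ Set.Icc (0 : ℝ) 1 := by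
  refine Fin.cases ha (fun r => ?_) r
  exact hn.interleave_mem_Icc hs r

theorem IsNear.nodes₂_mem_Icc (hn : IsNear t d p q) (hs : IsSeparated t d) {a b : ℝ}
    (ha : a ∈ Set.Icc (0 : ℝ) 1) (hb : b ∈ Set.Icc (0 : ℝ) 1) (r : Fin (2 * k + 2)) :
    nodes₂ a b p q r ∈ Set.Icc (0 : ℝ) 1 := by
  refine Fin.cases ha (fun r => ?_) r
  exact hn.nodes₁_mem_Icc hs hb r

theorem IsNear.nodes₃_mem_Icc (hn : IsNear t d p q) (hs : IsSeparated t d) {x a b : ℝ}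
    (hx : x ∈ Set.Icc (0 : ℝ) 1) (ha : a ∈ Set.Icc (0 : ℝ) 1) (hb : b ∈ Set.Icc (0 : ℝ) 1)
    (r : Fin (2 * k + 2 + 1)) : nodes₃ x a b p q r ∈ Set.Icc (0 : ℝ) 1 := by
  refine Fin.cases hx (fun r => ?_) r
  exact hn.nodes₂_mem_Icc hs ha hb r

theorem IsNear.abs_pairProd_le_one (hn : IsNear t d p q) (hs : IsSeparated t d) {a : ℝ}
    (ha : a ∈ Set.Icc (0 : ℝ) 1) : |pairProd p q a| ≤ 1 := by
  rw [pairProd, Finset.abs_prod]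
  refine Finset.prod_le_one (fun i _ => abs_nonneg _) fun i _ => ?_
  obtain ⟨h1, h2⟩ := hn.mem_Icc hs i
  rw [abs_mul]
  refine mul_le_one₀ ?_ (abs_nonneg _) ?_ <;> rw [abs_le] <;> constructor <;>
    linarith [ha.1, ha.2, h1.1, h1.2, h2.1, h2.2]

theorem IsNear.gapProd_pos (hn : IsNear t d p q) : 0 < gapProd p q :=
  Finset.prod_pos fun i _ => sub_pos.2 (hn.lt i)

/-- The factor that two nodes of the pairs contribute to `gapProd`: their distance if they form a
pair, and `1` otherwise. -/
def partnerGap (p q : Fin k → ℝ) (r r' : Fin (2 * k)) : ℝ :=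
  if (r : ℕ) % 2 = 0 ∧ (r' : ℕ) = r + 1 then q ⟨r / 2, by omega⟩ - p ⟨r / 2, by omega⟩ else 1

theorem prod_partnerGap (p q : Fin k → ℝ) :
    ∏ r : Fin (2 * k), ∏ r' ∈ Finset.Ioi r, partnerGap p q r r' = gapProd p q := by
  rw [prod_interleaved, gapProd]
  refine Finset.prod_congr rfl fun i _ => ?_
  have h1 : ∏ r' ∈ Finset.Ioi (oddIdx i), partnerGap p q (oddIdx i) r' = 1 := by
    refine Finset.prod_eq_one fun r' _ => ?_
    rw [partnerGap, if_neg]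
    simp only [oddIdx]; omega
  rw [h1, mul_one, Finset.prod_eq_single (oddIdx i)]
  · simp [partnerGap, evenIdx, oddIdx]
  · intro r' _ hne
    rw [partnerGap, if_neg]
    rintro ⟨_, h⟩
    exact hne (Fin.ext h)
  · intro h
    exact absurd (Finset.mem_Ioi.2 (by rw [Fin.lt_def]; simp [evenIdx, oddIdx])) h

theorem IsNear.factor_bounds (hn : IsNear t d p q) (hs : IsSeparated t d) {r r' : Fin (2 * k)}
    (h : r < r') :
    d * partnerGap p q r r' ≤ interleave p q r' - interleave p q r ∧
      interleave p q r' - interleave p q r ≤ partnerGap p q r r' ∧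
      0 < partnerGap p q r r' := by
  have hd := hs.pos
  have hd2 := hs.two_mul_le
  have hz := hn.interleave_mem_Icc hs
  have hle : interleave p q r' - interleave p q r ≤ 1 := by linarith [(hz r').2, (hz r).1]
  by_cases hp : (r : ℕ) % 2 = 0 ∧ (r' : ℕ) = r + 1
  · rcases eq_evenIdx_or_oddIdx r with ⟨i, rfl⟩ | ⟨i, rfl⟩
    swap
    · simp only [oddIdx] at hp; omega
    have : r' = oddIdx i := Fin.ext hp.2
    subst this
    have e : partnerGap p q (evenIdx i) (oddIdx i) = q i - p i := by
      simp [partnerGap, evenIdx, oddIdx]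
    have := hn.lt i
    rw [e, interleave_evenIdx, interleave_oddIdx]
    refine ⟨?_, le_rfl, by linarith⟩
    nlinarith
  · rw [partnerGap, if_neg hp]
    refine ⟨?_, hle, one_pos⟩
    have key : ∀ i j : Fin k, i < j → ∀ a b, |a - t i| ≤ d → |b - t j| ≤ d → d * 1 ≤ b - a := by
      intro i j hij a b ha hb
      have := hs.sep i j hij
      have := abs_le.1 ha
      have := abs_le.1 hb
      linarith
    have hl := hn.left
    have hr := hn.right
    rcases eq_evenIdx_or_oddIdx r with ⟨i, rfl⟩ | ⟨i, rfl⟩ <;>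
    rcases eq_evenIdx_or_oddIdx r' with ⟨j, rfl⟩ | ⟨j, rfl⟩ <;>
    simp only [interleave_evenIdx, interleave_oddIdx] <;>
    rw [Fin.lt_def] at h <;> simp only [evenIdx, oddIdx] at h hp <;>
    refine key i j (by rw [Fin.lt_def]; omega) _ _ ?_ ?_ <;> first | exact hl _ | exact hr _

/-- The Vandermonde determinant of the pairs is comparable to the product of the distances within
the pairs. -/
theorem exists_mul_gapProd_le_vandermonde (hs : IsSeparated t d) :
    ∃ K > (0 : ℝ), ∀ p q, IsNear t d p q →
      K * gapProd p q ≤ (Matrix.vandermonde (interleave p q)).det ∧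
        (Matrix.vandermonde (interleave p q)).det ≤ gapProd p q := by
  have hd := hs.pos
  refine ⟨∏ r : Fin (2 * k), ∏ r' ∈ Finset.Ioi r, d,
    Finset.prod_pos fun r _ => Finset.prod_pos fun r' _ => hd, fun p q hn => ?_⟩
  have h0 : ∀ r r' : Fin (2 * k), r < r' → 0 ≤ d * partnerGap p q r r' := fun r r' h =>
    mul_nonneg hd.le (hn.factor_bounds hs h).2.2.le
  constructor
  · rw [← prod_partnerGap, ← Finset.prod_mul_distrib]
    simp only [← Finset.prod_mul_distrib]
    rw [Matrix.det_vandermonde]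
    refine Finset.prod_le_prod (fun r _ => Finset.prod_nonneg fun r' hr => ?_) fun r _ =>
      Finset.prod_le_prod (fun r' hr => ?_) fun r' hr => ?_
    · exact h0 r r' (Finset.mem_Ioi.1 hr)
    · exact h0 r r' (Finset.mem_Ioi.1 hr)
    · exact (hn.factor_bounds hs (Finset.mem_Ioi.1 hr)).1
  · rw [← prod_partnerGap, Matrix.det_vandermonde]
    have h1 : ∀ r r' : Fin (2 * k), r < r' → 0 ≤ interleave p q r' - interleave p q r :=
      fun r r' h => (h0 r r' h).trans (hn.factor_bounds hs h).1
    refine Finset.prod_le_prod (fun r _ => Finset.prod_nonneg fun r' hr => ?_) fun r _ =>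
      Finset.prod_le_prod (fun r' hr => ?_) fun r' hr => ?_
    · exact h1 r r' (Finset.mem_Ioi.1 hr)
    · exact h1 r r' (Finset.mem_Ioi.1 hr)
    · exact (hn.factor_bounds hs (Finset.mem_Ioi.1 hr)).2.1

theorem IsNear.vandermonde_interleave_pos (hn : IsNear t d p q) (hs : IsSeparated t d) :
    0 < (Matrix.vandermonde (interleave p q)).det := by
  obtain ⟨K, hK, h⟩ := exists_mul_gapProd_le_vandermonde hs
  exact (mul_pos hK hn.gapProd_pos).trans_le (h p q hn).1

theorem IsNear.pairProd_zero_pos (hn : IsNear t d p q) (hs : IsSeparated t d) :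
    0 < pairProd p q 0 :=
  (pow_pos (pow_pos hs.pos 2) k).trans_le (hn.pow_le_pairProd hs.pos hs.zero_far)

theorem IsNear.pairProd_one_pos (hn : IsNear t d p q) (hs : IsSeparated t d) :
    0 < pairProd p q 1 :=
  (pow_pos (pow_pos hs.pos 2) k).trans_le (hn.pow_le_pairProd hs.pos hs.one_far)

theorem IsNear.vandermonde_nodes₃_neg (hn : IsNear t d p q) (hs : IsSeparated t d) {x : ℝ}
    (hx : x ∈ Set.Ioo (0 : ℝ) 1) (h : ∀ i, 0 < (p i - x) * (q i - x)) :
    (Matrix.vandermonde (nodes₃ x 0 1 p q)).det < 0 := by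
  rw [vandermonde_nodes₃]
  have h1 := hn.vandermonde_interleave_pos hs
  have h2 := hn.pairProd_zero_pos hs
  have h3 := hn.pairProd_one_pos hs
  have h4 := pairProd_pos h
  apply mul_neg_of_neg_of_pos
  · exact mul_neg_of_neg_of_pos (by linarith [hx.1]) (mul_pos (by linarith [hx.2]) h4)
  · rw [sub_zero, one_mul]; positivity

end bounds

theorem exists_isSeparated {k : ℕ} {t : Fin k → ℝ} (ht : StrictMono t)
    (ht01 : ∀ i, t i ∈ Set.Ioo (0 : ℝ) 1) : ∀ᶠ d in 𝓝[>] (0 : ℝ), IsSeparated t d := by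
  have small : ∀ b c : ℝ, 0 < c → ∀ᶠ d in 𝓝[>] (0 : ℝ), b * d ≤ c := by
    intro b c hc
    have h : Tendsto (fun d : ℝ => b * d) (𝓝[>] 0) (𝓝 0) := by
      have : Continuous fun d : ℝ => b * d := by fun_prop
      have := this.tendsto 0
      rw [mul_zero] at this
      exact this.mono_left nhdsWithin_le_nhds
    exact (h.eventually (eventually_lt_nhds hc)).mono fun d hd => hd.le
  have h1 : ∀ᶠ d in 𝓝[>] (0 : ℝ), ∀ i j, i < j → t i + 3 * d ≤ t j := by
    refine eventually_all.2 fun i => eventually_all.2 fun j => ?_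
    by_cases hij : i < j
    · filter_upwards [small 3 _ (sub_pos.2 (ht hij))] with d hd _
      linarith
    · exact Eventually.of_forall fun d h => absurd h hij
  have h2 : ∀ᶠ d in 𝓝[>] (0 : ℝ), ∀ i, 3 * d ≤ t i :=
    eventually_all.2 fun i => small 3 _ (ht01 i).1
  have h3 : ∀ᶠ d in 𝓝[>] (0 : ℝ), ∀ i, 3 * d ≤ 1 - t i :=
    eventually_all.2 fun i => small 3 _ (sub_pos.2 (ht01 i).2)
  filter_upwards [h1, h2, h3, small 2 1 one_pos, self_mem_nhdsWithin] with d h1 h2 h3 h4 h5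
  exact ⟨h5, h4, h1, h2, fun i => by linarith [h3 i]⟩

/-! ### Admissible configurations -/

/-- In an admissible configuration at a small scale, the points other than `0`, `1` and the
exceptional point form pairs, one near each `t_i`. -/
theorem IsAdmissible.exists_nodes {k : ℕ} {t : Fin k → ℝ} {d ρ : ℝ} (hs : IsSeparated t d)
    (hρ : ρ ≤ d) {τ : Fin (2 * k + 2 + 1) → ℝ} {l : Fin (2 * k + 2 + 1)}
    (h : IsAdmissible t ρ τ l) :
    ∃ p q, IsNear t ρ p q ∧ (∀ i, 0 < (p i - τ l) * (q i - τ l)) ∧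
      (∃ e : Equiv.Perm (Fin (2 * k + 2)), (τ ∘ l.succAbove) ∘ e = nodes₂ 0 1 p q) ∧
      ∃ e : Equiv.Perm (Fin (2 * k + 2 + 1)), τ ∘ e = nodes₃ (τ l) 0 1 p q := by
  -- An even nonzero number of points is at least two. That there are no further points follows
  -- from the injectivity of `E` below.
  have hpair : ∀ i, ∃ ab : Fin (2 * k + 2 + 1) × Fin (2 * k + 2 + 1),
      τ ab.1 ∈ nbhd t ρ i ∧ τ ab.2 ∈ nbhd t ρ i ∧ ab.1 < ab.2 := by
    intro i
    have hcard : 1 < {p | τ p ∈ nbhd t ρ i}.ncard := by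
      have h0 : 0 < {p | τ p ∈ nbhd t ρ i}.ncard := (Set.ncard_pos).2 (h.nonempty i)
      obtain ⟨c, hc⟩ := h.even i
      omega
    obtain ⟨a, b, ha, hb, hab⟩ := (Set.one_lt_ncard_iff).1 hcard
    rcases lt_or_gt_of_ne hab with hlt | hlt
    · exact ⟨(a, b), ha, hb, hlt⟩
    · exact ⟨(b, a), hb, ha, hlt⟩
  choose ab ha hb hlt using hpair
  let p : Fin k → ℝ := fun i => τ (ab i).1
  let q : Fin k → ℝ := fun i => τ (ab i).2
  have hn : IsNear t ρ p q := ⟨fun i => h.strictMono (hlt i), fun i => (ha i).2, fun i => (hb i).2⟩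
  have hn' : IsNear t d p q :=
    ⟨hn.lt, fun i => (hn.left i).trans hρ, fun i => (hn.right i).trans hρ⟩
  have hx : ∀ i, 0 < (p i - τ l) * (q i - τ l) := by
    intro i
    have h1 : ρ < |τ l - t i| := by
      by_contra hcon
      exact h.exceptional_notMem (Set.mem_iUnion.2 ⟨i, Set.Ioo_subset_Icc_self h.interior,
        not_lt.1 hcon⟩)
    have h2 := abs_le.1 (hn.left i)
    have h3 := abs_le.1 (hn.right i)
    rcases lt_abs.1 h1 with h4 | h4
    · exact mul_pos_of_neg_of_neg (by linarith) (by linarith)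
    · exact mul_pos (by linarith) (by linarith)
  let J : Fin (2 * k + 2) → Fin (2 * k + 2 + 1) :=
    Fin.cons (α := fun _ => Fin (2 * k + 2 + 1)) 0
      (Fin.cons (α := fun _ => Fin (2 * k + 2 + 1)) (Fin.last _)
        (interleave (fun i => (ab i).1) (fun i => (ab i).2)) :
          Fin (2 * k + 1) → Fin (2 * k + 2 + 1))
  let E : Fin (2 * k + 2 + 1) → Fin (2 * k + 2 + 1) :=
    Fin.cons (α := fun _ => Fin (2 * k + 2 + 1)) l J
  have hJ : τ ∘ J = nodes₂ 0 1 p q := by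
    funext r
    refine Fin.cases h.first (fun r => ?_) r
    refine Fin.cases h.last (fun r => ?_) r
    rcases eq_evenIdx_or_oddIdx r with ⟨i, rfl⟩ | ⟨i, rfl⟩ <;>
    simp [J, nodes₂, nodes₁, p, q]
  have hE : τ ∘ E = nodes₃ (τ l) 0 1 p q := by
    funext r
    refine Fin.cases rfl (fun r => ?_) r
    exact congrFun hJ r
  -- The nodes are distinct because their Vandermonde determinant does not vanish.
  have hEinj : Function.Injective E := by
    have := Matrix.det_vandermonde_ne_zero_iff.1 (hn'.vandermonde_nodes₃_neg hs h.interior hx).ne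
    rw [← hE] at this
    exact this.of_comp
  have hne : ∀ r, J r ≠ l := fun r hr =>
    absurd (hEinj (a₁ := r.succ) (a₂ := 0) hr) (Fin.succ_ne_zero r)
  choose w hw using fun r => Fin.exists_succAbove_eq (hne r)
  have hwinj : Function.Injective w := by
    intro a b hab
    have : J a = J b := by rw [← hw a, ← hw b, hab]
    exact Fin.succ_injective _ (hEinj (a₁ := a.succ) (a₂ := b.succ) this)
  refine ⟨p, q, hn, hx, ⟨Equiv.ofBijective w (Finite.injective_iff_bijective.1 hwinj), ?_⟩,
    ⟨Equiv.ofBijective E (Finite.injective_iff_bijective.1 hEinj), hE⟩⟩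
  rw [← hJ]
  funext r
  simp [hw]

/-- Criterion for T*-systems in terms of the nodes `x, 0, 1` and pairs close to the `t_i`: as the
nodes in this order have a negative Vandermonde determinant, the determinant has to be nonpositive
there. The minors have to be comparable to the product of the distances within the pairs. -/
theorem isTStarSystem_of_eventually {k : ℕ} (hk : 0 < k) {t : Fin k → ℝ} (ht : StrictMono t)
    (ht01 : ∀ i, t i ∈ Set.Ioo (0 : ℝ) 1) {u : Fin (2 * k + 2 + 1) → ℝ → ℝ} {c C : ℝ}
    (hc : 0 < c) (hC : 0 < C)
    (hdet : ∀ᶠ pq : (Fin k → ℝ) × (Fin k → ℝ) in 𝓝 (t, t), (∀ i, pq.1 i < pq.2 i) →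
      ∀ x ∈ Set.Ioo (0 : ℝ) 1, (∀ i, 0 < (pq.1 i - x) * (pq.2 i - x)) →
        (collocation u (nodes₃ x 0 1 pq.1 pq.2)).det ≤ 0)
    (hminor : ∀ᶠ pq : (Fin k → ℝ) × (Fin k → ℝ) in 𝓝 (t, t), (∀ i, pq.1 i < pq.2 i) → ∀ j,
      c * gapProd pq.1 pq.2 ≤
        |(collocation (fun a => u (Fin.succAbove j a)) (nodes₂ 0 1 pq.1 pq.2)).det| ∧
      |(collocation (fun a => u (Fin.succAbove j a)) (nodes₂ 0 1 pq.1 pq.2)).det| ≤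
        C * gapProd pq.1 pq.2) :
    IsTStarSystem t u := by
  obtain ⟨d, hs⟩ := (exists_isSeparated ht ht01).exists
  obtain ⟨ρ₁, hρ₁, hev⟩ := Metric.eventually_nhds_iff.1 (hdet.and hminor)
  have hd := hs.pos
  have key : ∀ ρ, 0 < ρ → ρ < min ρ₁ d → ∀ (τ : Fin (2 * k + 2 + 1) → ℝ) l,
      IsAdmissible t ρ τ l → 0 ≤ (collocation u τ).det ∧
      ∃ G, 0 < G ∧ G ≤ 2 * ρ ∧ ∀ j, c * G ≤ |minor (collocation u τ) l j| ∧
        |minor (collocation u τ) l j| ≤ C * G := by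
    intro ρ hρ hρ0 τ l hadm
    have hρd : ρ < d := hρ0.trans_le (min_le_right _ _)
    obtain ⟨p, q, hn, hx, ⟨e, he⟩, ⟨e', he'⟩⟩ := hadm.exists_nodes hs hρd.le
    have hn' : IsNear t d p q :=
      ⟨hn.lt, fun i => (hn.left i).trans hρd.le, fun i => (hn.right i).trans hρd.le⟩
    have hdist : dist (p, q) (t, t) < ρ₁ := by
      refine lt_of_le_of_lt ?_ (hρ0.trans_le (min_le_left _ _))
      rw [Prod.dist_eq]
      exact max_le ((dist_pi_le_iff hρ.le).2 hn.left) ((dist_pi_le_iff hρ.le).2 hn.right)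
    obtain ⟨h1, h2⟩ := hev hdist
    constructor
    · have h3 := h1 hn.lt (τ l) hadm.interior hx
      have h4 := hn'.vandermonde_nodes₃_neg hs hadm.interior hx
      -- The sign of the product with the Vandermonde determinant does not depend on the order.
      have h5 := det_mul_det_comp_perm (fun j y => y ^ (j : ℕ)) u τ e'
      rw [he', ← det_vandermonde_eq_collocation, ← det_vandermonde_eq_collocation] at h5
      have h6 := vandermonde_pos_of_strictMono hadm.strictMono
      have h7 := mul_nonneg_of_nonpos_of_nonpos h4.le h3
      rw [h5] at h7
      exact nonneg_of_mul_nonneg_right h7 h6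
    · refine ⟨gapProd p q, hn.gapProd_pos, ?_, fun j => ?_⟩
      · have hgap : ∀ i, q i - p i ≤ 2 * ρ := fun i => by
          have := abs_le.1 (hn.left i)
          have := abs_le.1 (hn.right i)
          linarith
        have h3 : gapProd p q ≤ ∏ _i : Fin k, 2 * ρ :=
          Finset.prod_le_prod (fun i _ => (sub_pos.2 (hn.lt i)).le) fun i _ => hgap i
        rw [Finset.prod_const, Finset.card_univ, Fintype.card_fin] at h3
        refine h3.trans (pow_le_of_le_one (by positivity) ?_ hk.ne')
        linarith [hs.two_mul_le]
      · have h3 := h2 hn.lt j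
        rw [← he, abs_det_collocation_comp_perm] at h3
        exact h3
  have hpos : 0 < min ρ₁ d := lt_min hρ₁ hd
  refine ⟨⟨k + 1, by ring⟩, le_rfl, ⟨_, hpos, fun ρ h1 h2 τ l h => (key ρ h1 h2 τ l h).1⟩,
    fun δ hδ => ?_, ⟨C / c, by positivity, _, hpos, fun ρ h1 h2 τ l h j => ?_⟩⟩
  · refine ⟨min (min ρ₁ d) (δ / (2 * C)), lt_min hpos (by positivity), fun ρ h1 h2 τ l h j => ?_⟩
    obtain ⟨-, G, hG, hGρ, hj⟩ := key ρ h1 (h2.trans_le (min_le_left _ _)) τ l h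
    have h3 := (lt_div_iff₀ (by positivity)).1 (h2.trans_le (min_le_right _ _))
    refine (hj j).2.trans ?_
    nlinarith
  · obtain ⟨-, G, hG, hGρ, hj⟩ := key ρ h1 h2 τ l h
    have hcG : 0 < c * G := mul_pos hc hG
    refine ⟨abs_pos.1 (hcG.trans_le (hj j).1), fun j' => ?_⟩
    rw [div_mul_eq_mul_div, le_div_iff₀ hc]
    have h3 := (hj j).2
    have h4 := (hj j').1
    nlinarith

/-! ### Expansion along the column of the dual function -/

section expansion

variable {k : ℕ} {p q : Fin k → ℝ}

/-- Expansion along the first column, for a function that vanishes on the pairs. -/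
theorem det_cons_nodes₃ (φ : Fin (2 * k + 2) → ℝ → ℝ) {F : ℝ → ℝ} (hp : ∀ i, F (p i) = 0)
    (hq : ∀ i, F (q i) = 0) (x a b : ℝ) :
    (collocation (Fin.cons (α := fun _ => ℝ → ℝ) F φ) (nodes₃ x a b p q)).det =
      F x * (collocation φ (nodes₂ a b p q)).det - F a * (collocation φ (nodes₂ x b p q)).det +
        F b * (collocation φ (nodes₂ x a p q)).det := by
  set A := collocation (Fin.cons (α := fun _ => ℝ → ℝ) F φ) (nodes₃ x a b p q) with hA
  have hz : ∀ r : Fin (2 * k), A r.succ.succ.succ 0 = 0 := by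
    intro r
    rcases eq_evenIdx_or_oddIdx r with ⟨i, rfl⟩ | ⟨i, rfl⟩ <;>
    simp [hA, collocation, nodes₃, nodes₂, nodes₁, hp, hq]
  have e0 : A.submatrix (Fin.succAbove 0) Fin.succ = collocation φ (nodes₂ a b p q) := rfl
  have e1 : A.submatrix (Fin.succAbove (Fin.succ 0)) Fin.succ =
      collocation φ (nodes₂ x b p q) := by
    ext r j
    refine Fin.cases rfl (fun r => ?_) r
    rfl
  have e2 : A.submatrix (Fin.succAbove (Fin.succ (Fin.succ 0))) Fin.succ =
      collocation φ (nodes₂ x a p q) := by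
    ext r j
    refine Fin.cases rfl (fun r => ?_) r
    refine Fin.cases rfl (fun r => ?_) r
    rfl
  have a0 : A 0 0 = F x := rfl
  have a1 : A (Fin.succ 0) 0 = F a := rfl
  have a2 : A (Fin.succ (Fin.succ 0)) 0 = F b := rfl
  rw [Matrix.det_succ_column_zero, Fin.sum_univ_succ, Fin.sum_univ_succ, Fin.sum_univ_succ]
  simp only [hz, e0, e1, e2, a0, a1, a2]
  simp only [Fin.val_zero, Fin.val_succ, mul_zero, zero_mul, Finset.sum_const_zero, add_zero]
  ring

/-- Expansion along the first column, for a function that vanishes on the pairs. -/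
theorem det_cons_nodes₂ (φ : Fin (2 * k + 1) → ℝ → ℝ) {F : ℝ → ℝ} (hp : ∀ i, F (p i) = 0)
    (hq : ∀ i, F (q i) = 0) (a b : ℝ) :
    (collocation (Fin.cons (α := fun _ => ℝ → ℝ) F φ) (nodes₂ a b p q)).det =
      F a * (collocation φ (nodes₁ b p q)).det - F b * (collocation φ (nodes₁ a p q)).det := by
  set A := collocation (Fin.cons (α := fun _ => ℝ → ℝ) F φ) (nodes₂ a b p q) with hA
  have hz : ∀ r : Fin (2 * k), A r.succ.succ 0 = 0 := by
    intro r
    rcases eq_evenIdx_or_oddIdx r with ⟨i, rfl⟩ | ⟨i, rfl⟩ <;>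
    simp [hA, collocation, nodes₂, nodes₁, hp, hq]
  have e0 : A.submatrix (Fin.succAbove 0) Fin.succ = collocation φ (nodes₁ b p q) := rfl
  have e1 : A.submatrix (Fin.succAbove (Fin.succ 0)) Fin.succ = collocation φ (nodes₁ a p q) := by
    ext r j
    refine Fin.cases rfl (fun r => ?_) r
    rfl
  have a0 : A 0 0 = F a := rfl
  have a1 : A (Fin.succ 0) 0 = F b := rfl
  rw [Matrix.det_succ_column_zero, Fin.sum_univ_succ, Fin.sum_univ_succ]
  simp only [hz, e0, e1, a0, a1]
  simp only [Fin.val_zero, Fin.val_succ, mul_zero, zero_mul, Finset.sum_const_zero, add_zero]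
  ring

theorem det_collocation_cons_add {n : ℕ} (φ : Fin n → ℝ → ℝ) {F F' h : ℝ → ℝ}
    {x : Fin (n + 1) → ℝ} (hF : ∀ r, F (x r) = F' (x r) + h (x r)) :
    (collocation (Fin.cons (α := fun _ => ℝ → ℝ) F φ) x).det =
      (collocation (Fin.cons (α := fun _ => ℝ → ℝ) F' φ) x).det +
        (collocation (Fin.cons (α := fun _ => ℝ → ℝ) h φ) x).det := by
  rw [Matrix.det_succ_column_zero, Matrix.det_succ_column_zero, Matrix.det_succ_column_zero,
    ← Finset.sum_add_distrib]
  refine Finset.sum_congr rfl fun r _ => ?_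
  have e : ∀ G : ℝ → ℝ, (collocation (Fin.cons (α := fun _ => ℝ → ℝ) G φ) x).submatrix
      r.succAbove Fin.succ = Matrix.of fun i j => φ j (x (r.succAbove i)) := fun G => rfl
  have e0 : ∀ G : ℝ → ℝ, collocation (Fin.cons (α := fun _ => ℝ → ℝ) G φ) x r 0 = G (x r) :=
    fun G => rfl
  rw [e, e, e, e0, e0, e0, hF r]
  ring

theorem pairDet₂_swap (u : Fin (2 * k + 2) → ℝ → ℝ) (A B : Fin (2 * k + 2) → ℝ) :
    pairDet₂ u B A p q = -pairDet₂ u A B p q := by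
  have h := Matrix.det_permute (Equiv.swap (0 : Fin (2 * k + 2)) 1)
    (Matrix.of (Fin.cons (α := fun _ => Fin (2 * k + 2) → ℝ) A
    (Fin.cons (α := fun _ => Fin (2 * k + 2) → ℝ) B (pairRows u p q) :
      Fin (2 * k + 1) → Fin (2 * k + 2) → ℝ)))
  rw [Equiv.Perm.sign_swap (by simp)] at h
  simp only [Units.val_neg, Units.val_one, Int.cast_neg, Int.cast_one, neg_one_mul] at h
  rw [pairDet₂, pairDet₂, ← h]
  congr 1
  funext r
  refine Fin.cases ?_ (fun r => ?_) r
  · change B = _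
    funext j
    rw [Matrix.submatrix_apply, Equiv.swap_apply_left]
    rfl
  refine Fin.cases ?_ (fun r => ?_) r
  · change A = _
    funext j
    rw [Matrix.submatrix_apply]
    change A j = Matrix.of _ ((Equiv.swap (0 : Fin (2 * k + 2)) 1) 1) j
    rw [Equiv.swap_apply_right]
    rfl
  · funext j
    rw [Matrix.submatrix_apply, Equiv.swap_apply_of_ne_of_ne]
    · rfl
    · exact Fin.succ_ne_zero _
    · intro h
      have := congrArg Fin.val h
      simp at this

end expansion

/-! ### Determinants of the Gaussian windows -/

section windows

variable {k n : ℕ} {σ : ℝ}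

theorem contDiff_gaussianWindow (σ : ℝ) (s : Fin n → ℝ) (j : Fin n) :
    ContDiff ℝ (⊤ : ℕ∞) (gaussianWindow σ s j) := by
  unfold gaussianWindow gaussianFn
  fun_prop

theorem differentiable_gaussianWindow (σ : ℝ) (s : Fin n → ℝ) (j : Fin n) :
    Differentiable ℝ (gaussianWindow σ s j) :=
  (contDiff_infty_iff_deriv.1 (contDiff_gaussianWindow σ s j)).1

theorem continuous_deriv_gaussianWindow (σ : ℝ) (s : Fin n → ℝ) (j : Fin n) :
    Continuous (deriv (gaussianWindow σ s j)) :=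
  (contDiff_infty_iff_deriv.1 (contDiff_gaussianWindow σ s j)).2.continuous

theorem supportRows_eq (σ : ℝ) (t : Fin k → ℝ) (s : Fin n → ℝ) :
    supportRows σ t s = pairRows (gaussianWindow σ s) t t := by
  funext r j
  simp only [supportRows, pairRows, interleave]
  split_ifs
  · rfl
  · rw [divDiffRow, divDiff_self]
    exact (deriv_comp_sub_const (f := gaussianFn σ) (s j) _).symm

/-- The determinant with the rows of the windows at `a`, at `b`, and of the pairs. -/
noncomputable def windowDet (σ : ℝ) (s : Fin (2 * k + 2) → ℝ) (a b : ℝ) (p q : Fin k → ℝ) : ℝ :=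
  pairDet₂ (gaussianWindow σ s) (valueRow (gaussianWindow σ s) a) (valueRow (gaussianWindow σ s) b)
    p q

/-- The determinant with the row of the windows at `a`, the row of their divided differences at
`x, 1`, and the rows of the pairs. -/
noncomputable def slopeDet (σ : ℝ) (s : Fin (2 * k + 2) → ℝ) (a x : ℝ) (p q : Fin k → ℝ) : ℝ :=
  pairDet₂ (gaussianWindow σ s) (valueRow (gaussianWindow σ s) a)
    (divDiffRow (gaussianWindow σ s) x 1) p q

/-- The determinant with the row of the windows at `a` and the rows of the pairs. -/
noncomputable def windowDet₁ (σ : ℝ) (s : Fin (2 * k + 1) → ℝ) (a : ℝ) (p q : Fin k → ℝ) : ℝ :=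
  pairDet₁ (gaussianWindow σ s) (valueRow (gaussianWindow σ s) a) p q

theorem borderedDet_eq (σ : ℝ) (t : Fin k → ℝ) (s : Fin (2 * k + 2) → ℝ) (a b : ℝ) :
    borderedDet σ t s a b = windowDet σ s a b t t := by
  rw [borderedDet, supportRows_eq, det_snoc, windowDet, pairDet₂_swap, pow_succ, pow_mul]
  simp only [even_two, Even.neg_pow, one_pow, one_mul, neg_one_mul]
  rfl

theorem minorAtOne_eq (σ : ℝ) (t : Fin k → ℝ) (s : Fin (2 * k + 2) → ℝ) (j : Fin (2 * k + 2)) :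
    minorAtOne σ t s j = windowDet₁ σ (s ∘ j.succAbove) 1 t t := by
  rw [minorAtOne, supportRows_eq, det_snoc, pow_mul]
  simp only [even_two, Even.neg_pow, one_pow, one_mul]
  rfl

theorem minorAtZero_eq (σ : ℝ) (t : Fin k → ℝ) (s : Fin (2 * k + 2) → ℝ) (j : Fin (2 * k + 2)) :
    minorAtZero σ t s j = windowDet₁ σ (s ∘ j.succAbove) 0 t t := by
  rw [minorAtZero, supportRows_eq]
  rfl

theorem det_window_nodes₂ (σ : ℝ) (s : Fin (2 * k + 2) → ℝ) (a b : ℝ) (p q : Fin k → ℝ) :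
    (collocation (gaussianWindow σ s) (nodes₂ a b p q)).det =
      gapProd p q * windowDet σ s a b p q :=
  det_collocation_nodes₂ (differentiable_gaussianWindow σ s) (continuous_deriv_gaussianWindow σ s)
    a b p q

theorem det_window_nodes₁ (σ : ℝ) (s : Fin (2 * k + 1) → ℝ) (a : ℝ) (p q : Fin k → ℝ) :
    (collocation (gaussianWindow σ s) (nodes₁ a p q)).det =
      gapProd p q * windowDet₁ σ s a p q :=
  det_collocation_nodes₁ (differentiable_gaussianWindow σ s) (continuous_deriv_gaussianWindow σ s)
    a p q

theorem windowDet_swap (σ : ℝ) (s : Fin (2 * k + 2) → ℝ) (a b : ℝ) (p q : Fin k → ℝ) :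
    windowDet σ s b a p q = -windowDet σ s a b p q := pairDet₂_swap _ _ _

theorem windowDet_self (σ : ℝ) (s : Fin (2 * k + 2) → ℝ) (a : ℝ) (p q : Fin k → ℝ) :
    windowDet σ s a a p q = 0 := pairDet₂_self _ _ _ _

theorem windowDet_one (σ : ℝ) (s : Fin (2 * k + 2) → ℝ) (a x : ℝ) (p q : Fin k → ℝ) :
    windowDet σ s a 1 p q = windowDet σ s a x p q + (1 - x) * slopeDet σ s a x p q := by
  rw [windowDet, valueRow_eq_add_smul (differentiable_gaussianWindow σ s)
    (continuous_deriv_gaussianWindow σ s) x 1, pairDet₂_add_smul]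
  rfl

theorem windowDet_one_right (σ : ℝ) (s : Fin (2 * k + 2) → ℝ) (x : ℝ) (p q : Fin k → ℝ) :
    windowDet σ s x 1 p q = (1 - x) * slopeDet σ s x x p q := by
  rw [windowDet_one σ s x x, windowDet_self, zero_add]

section continuity

variable {X : Type*} [TopologicalSpace X]

theorem continuous_valueRow {a : X → ℝ} (ha : Continuous a) (s : Fin n → ℝ) :
    Continuous fun x => valueRow (gaussianWindow σ s) (a x) :=
  continuous_pi fun j => (differentiable_gaussianWindow σ s j).continuous.comp ha

theorem continuous_divDiffRow {a b : X → ℝ} (ha : Continuous a) (hb : Continuous b)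
    (s : Fin n → ℝ) : Continuous fun x => divDiffRow (gaussianWindow σ s) (a x) (b x) :=
  continuous_pi fun j =>
    (continuous_divDiff (continuous_deriv_gaussianWindow σ s j)).comp (ha.prodMk hb)

theorem continuous_windowDet {a b : X → ℝ} (ha : Continuous a) (hb : Continuous b)
    (s : Fin (2 * k + 2) → ℝ) {p q : X → Fin k → ℝ} (hp : Continuous p) (hq : Continuous q) :
    Continuous fun x => windowDet σ s (a x) (b x) (p x) (q x) :=
  continuous_pairDet₂ (differentiable_gaussianWindow σ s) (continuous_deriv_gaussianWindow σ s)
    (continuous_valueRow ha s) (continuous_valueRow hb s) hp hq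

theorem continuous_slopeDet {a b : X → ℝ} (ha : Continuous a) (hb : Continuous b)
    (s : Fin (2 * k + 2) → ℝ) {p q : X → Fin k → ℝ} (hp : Continuous p) (hq : Continuous q) :
    Continuous fun x => slopeDet σ s (a x) (b x) (p x) (q x) :=
  continuous_pairDet₂ (differentiable_gaussianWindow σ s) (continuous_deriv_gaussianWindow σ s)
    (continuous_valueRow ha s) (continuous_divDiffRow hb continuous_const s) hp hq

theorem continuous_windowDet₁ {a : X → ℝ} (ha : Continuous a)
    (s : Fin (2 * k + 1) → ℝ) {p q : X → Fin k → ℝ} (hp : Continuous p) (hq : Continuous q) :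
    Continuous fun x => windowDet₁ σ s (a x) (p x) (q x) :=
  continuous_pairDet₁ (differentiable_gaussianWindow σ s) (continuous_deriv_gaussianWindow σ s)
    (continuous_valueRow ha s) hp hq

end continuity

theorem exists_le_of_pos {ι : Type*} [Finite ι] (a : ι → ℝ) (ha : ∀ i, 0 < a i) :
    ∃ c > (0 : ℝ), ∀ i, c ≤ a i := by
  have h : ∀ᶠ c in 𝓝[>] (0 : ℝ), ∀ i, c ≤ a i := eventually_all.2 fun i =>
    ((eventually_lt_nhds (ha i)).filter_mono nhdsWithin_le_nhds).mono fun c hc => hc.le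
  obtain ⟨c, h1, h2⟩ := (h.and self_mem_nhdsWithin).exists
  exact ⟨c, h2, h1⟩

theorem exists_ge_of_finite {ι : Type*} [Finite ι] (a : ι → ℝ) :
    ∃ C > (0 : ℝ), ∀ i, a i ≤ C := by
  obtain ⟨C, h1, h2⟩ := ((eventually_all.2 fun i => eventually_ge_atTop (a i)).and
    (eventually_gt_atTop (0 : ℝ))).exists
  exact ⟨C, h2, h1⟩

variable {t : Fin k → ℝ} {d : ℝ}

theorem eventually_isNear (hd : 0 < d) :
    ∀ᶠ pq : (Fin k → ℝ) × (Fin k → ℝ) in 𝓝 (t, t), (∀ i, pq.1 i < pq.2 i) →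
      IsNear t d pq.1 pq.2 := by
  filter_upwards [Metric.closedBall_mem_nhds (t, t) hd] with pq hpq hlt
  rw [Metric.mem_closedBall, Prod.dist_eq, max_le_iff, dist_pi_le_iff hd.le,
    dist_pi_le_iff hd.le] at hpq
  exact ⟨hlt, hpq.1, hpq.2⟩

/-- Pairs with distinct points, shrinking to `t`. -/
theorem tendsto_add_right (t : Fin k → ℝ) :
    Tendsto (fun η : ℝ => ((t, fun i => t i + η) : (Fin k → ℝ) × (Fin k → ℝ))) (𝓝[>] 0)
      (𝓝 (t, t)) := by
  have h : Continuous fun η : ℝ => ((t, fun i => t i + η) : (Fin k → ℝ) × (Fin k → ℝ)) := by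
    fun_prop
  have := h.tendsto 0
  simp only [add_zero] at this
  exact this.mono_left nhdsWithin_le_nhds

/-- A lower bound that holds for all nearby pairs of distinct points holds at `t` itself. -/
theorem le_of_isNear (hd : 0 < d) {f : (Fin k → ℝ) × (Fin k → ℝ) → ℝ} (hf : Continuous f) {c : ℝ}
    (h : ∀ p q, IsNear t d p q → c ≤ f (p, q)) : c ≤ f (t, t) := by
  have h1 := (hf.tendsto (t, t)).comp (tendsto_add_right t)
  refine ge_of_tendsto h1 ?_
  filter_upwards [(tendsto_add_right t).eventually (eventually_isNear hd), self_mem_nhdsWithin]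
    with η hη hη0
  exact h _ _ (hη fun i => by simpa using hη0)

theorem vandermonde_le_gaussian_of_pos {c : ℝ} {s x : Fin n → ℝ}
    (h : c * (Matrix.vandermonde x).det ^ 2 ≤
      (Matrix.vandermonde x).det * (collocation (gaussianWindow σ s) x).det)
    (hV : 0 ≤ (Matrix.vandermonde x).det) (hD : (Matrix.vandermonde x).det ≠ 0) :
    c * (Matrix.vandermonde x).det ≤ (collocation (gaussianWindow σ s) x).det := by
  have hV' := lt_of_le_of_ne hV hD.symm
  refine le_of_mul_le_mul_left ?_ hV'
  linarith

/-- For `a, b` away from the pairs, the Vandermonde determinant is of the order of `b - a` times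
the distances within the pairs. -/
theorem exists_le_vandermonde_nodes₂ (hs : IsSeparated t d) :
    ∃ c > (0 : ℝ), ∀ a b, (∀ i, 2 * d ≤ |a - t i|) → (∀ i, 2 * d ≤ |b - t i|) → a ≤ b →
      ∀ p q, IsNear t d p q →
        c * (b - a) * gapProd p q ≤ (Matrix.vandermonde (nodes₂ a b p q)).det := by
  obtain ⟨K, hK, h⟩ := exists_mul_gapProd_le_vandermonde hs
  have hd := hs.pos
  refine ⟨(d ^ 2) ^ k * ((d ^ 2) ^ k * K), by positivity, fun a b ha hb hab p q hn => ?_⟩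
  rw [vandermonde_nodes₂]
  have h1 := hn.pow_le_pairProd hd ha
  have h2 := hn.pow_le_pairProd hd hb
  have h3 := (h p q hn).1
  have hG := hn.gapProd_pos
  have h0 : 0 < (d ^ 2) ^ k := by positivity
  calc _ = (b - a) * (d ^ 2) ^ k * ((d ^ 2) ^ k * (K * gapProd p q)) := by ring
    _ ≤ _ := by
      have hba := sub_nonneg.2 hab
      have : 0 < pairProd p q b := h0.trans_le h2
      have : 0 < pairProd p q a := h0.trans_le h1
      gcongr

theorem exists_le_windowDet (hσ : 0 < σ) {s : Fin (2 * k + 2) → ℝ} (hs : StrictMono s)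
    (ht : IsSeparated t d) :
    ∃ c > (0 : ℝ), ∀ a ∈ Set.Icc (0 : ℝ) 1, ∀ b ∈ Set.Icc (0 : ℝ) 1, (∀ i, 2 * d ≤ |a - t i|) →
      (∀ i, 2 * d ≤ |b - t i|) → a ≤ b → (∀ p q, IsNear t d p q →
        c * (b - a) ≤ windowDet σ s a b p q) ∧ c * (b - a) ≤ windowDet σ s a b t t := by
  obtain ⟨c, hc, h⟩ := exists_vandermonde_sq_le_gaussian hσ hs
  obtain ⟨c', hc', h'⟩ := exists_le_vandermonde_nodes₂ ht
  refine ⟨c * c', by positivity, fun a ha b hb ha' hb' hab => ?_⟩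
  have main : ∀ p q, IsNear t d p q → c * c' * (b - a) ≤ windowDet σ s a b p q := by
    intro p q hn
    rcases hab.eq_or_lt with rfl | hlt
    · rw [windowDet_self]; simp
    have hG := hn.gapProd_pos
    have h1 := h' a b ha' hb' hab p q hn
    have h0 : 0 < (Matrix.vandermonde (nodes₂ a b p q)).det :=
      (mul_pos (mul_pos hc' (sub_pos.2 hlt)) hG).trans_le h1
    have h2 := vandermonde_le_gaussian_of_pos (h _ (hn.nodes₂_mem_Icc ht ha hb)) h0.le h0.ne'
    rw [det_window_nodes₂] at h2
    refine le_of_mul_le_mul_left ?_ hG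
    calc _ = c * (c' * (b - a) * gapProd p q) := by ring
      _ ≤ _ := mul_le_mul_of_nonneg_left h1 hc.le
      _ ≤ _ := h2
  exact ⟨main, le_of_isNear ht.pos (f := fun pq => windowDet σ s a b pq.1 pq.2)
    (continuous_windowDet continuous_const continuous_const s continuous_fst continuous_snd) main⟩

theorem exists_le_windowDet₁ (hσ : 0 < σ) {s : Fin (2 * k + 1) → ℝ} (hs : StrictMono s)
    (ht : IsSeparated t d) :
    ∃ c > (0 : ℝ), (∀ p q, IsNear t d p q → c ≤ windowDet₁ σ s 1 p q) ∧
      c ≤ windowDet₁ σ s 1 t t := by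
  obtain ⟨c, hc, h⟩ := exists_vandermonde_sq_le_gaussian hσ hs
  obtain ⟨K, hK, hV⟩ := exists_mul_gapProd_le_vandermonde ht
  have hd := ht.pos
  have main : ∀ p q, IsNear t d p q → c * ((d ^ 2) ^ k * K) ≤ windowDet₁ σ s 1 p q := by
    intro p q hn
    have hG := hn.gapProd_pos
    have h1 : (d ^ 2) ^ k * K * gapProd p q ≤ (Matrix.vandermonde (nodes₁ 1 p q)).det := by
      rw [vandermonde_nodes₁, mul_assoc]
      exact mul_le_mul (hn.pow_le_pairProd hd ht.one_far) (hV p q hn).1 (by positivity)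
        (hn.pairProd_one_pos ht).le
    have h0 : 0 < (Matrix.vandermonde (nodes₁ 1 p q)).det := lt_of_lt_of_le (by positivity) h1
    have h2 := vandermonde_le_gaussian_of_pos (h _ (hn.nodes₁_mem_Icc ht ⟨zero_le_one, le_rfl⟩))
      h0.le h0.ne'
    rw [det_window_nodes₁] at h2
    refine le_of_mul_le_mul_left ?_ hG
    calc _ = c * ((d ^ 2) ^ k * K * gapProd p q) := by ring
      _ ≤ _ := mul_le_mul_of_nonneg_left h1 hc.le
      _ ≤ _ := h2
  exact ⟨c * ((d ^ 2) ^ k * K), by positivity, main,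
    le_of_isNear hd (f := fun pq => windowDet₁ σ s 1 pq.1 pq.2)
    (continuous_windowDet₁ continuous_const s continuous_fst continuous_snd) main⟩

end windows

/-! ### The limiting conditions -/

section farSet

variable {k : ℕ} {σ ε d : ℝ} {t : Fin k → ℝ}

/-- The closure of the part of `(0, 1)` outside `T_ε`. -/
def farSet (t : Fin k → ℝ) (ε : ℝ) : Set ℝ := closure (Set.Ioo (0 : ℝ) 1 \ nbhdAll t ε)

theorem lt_abs_sub_of_notMem {x : ℝ} (hx : x ∈ Set.Ioo (0 : ℝ) 1) (h : x ∉ nbhdAll t ε)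
    (i : Fin k) : ε < |x - t i| := by
  by_contra hcon
  exact h (Set.mem_iUnion.2 ⟨i, Set.Ioo_subset_Icc_self hx, not_lt.1 hcon⟩)

theorem farSet_subset : farSet t ε ⊆ {x | x ∈ Set.Icc (0 : ℝ) 1 ∧ ∀ i, ε ≤ |x - t i|} := by
  have h : IsClosed (Set.Icc (0 : ℝ) 1 ∩ ⋂ i, {x | ε ≤ |x - t i|}) :=
    isClosed_Icc.inter (isClosed_iInter fun i => isClosed_le continuous_const (by fun_prop))
  have h' : farSet t ε ⊆ Set.Icc (0 : ℝ) 1 ∩ ⋂ i, {x | ε ≤ |x - t i|} :=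
    closure_minimal (fun x hx => ⟨Set.Ioo_subset_Icc_self hx.1,
      Set.mem_iInter.2 fun i => (lt_abs_sub_of_notMem hx.1 hx.2 i).le⟩) h
  exact fun x hx => ⟨(h' hx).1, fun i => Set.mem_iInter.1 (h' hx).2 i⟩

theorem isCompact_farSet : IsCompact (farSet t ε) :=
  isCompact_Icc.of_isClosed_subset isClosed_closure fun _ hx => (farSet_subset hx).1

theorem le_on_farSet {f g : ℝ → ℝ} (hf : Continuous f) (hg : Continuous g)
    (h : ∀ x ∈ Set.Ioo (0 : ℝ) 1 \ nbhdAll t ε, f x ≤ g x) : ∀ x ∈ farSet t ε, f x ≤ g x :=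
  fun _ hx => closure_minimal h (isClosed_le hf hg) hx

theorem eventually_forall_pos {Y : Type*} [TopologicalSpace Y] {K : Set ℝ} (hK : IsCompact K)
    {f : ℝ → Y → ℝ} (hf : Continuous fun z : Y × ℝ => f z.2 z.1) {y₀ : Y}
    (h : ∀ x ∈ K, 0 < f x y₀) : ∀ᶠ y in 𝓝 y₀, ∀ x ∈ K, 0 < f x y :=
  hK.eventually_forall_of_forall_eventually fun x hx =>
    (hf.tendsto (y₀, x)).eventually (eventually_gt_nhds (h x hx))

theorem continuous_section {Y : Type*} [TopologicalSpace Y] {f : ℝ → Y → ℝ}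
    (hf : Continuous fun z : Y × ℝ => f z.2 z.1) (y : Y) : Continuous fun x => f x y :=
  hf.comp (continuous_const.prodMk continuous_id)

/-- At `x = 1` the row of divided differences is the row of derivatives, so this is positivity of
a determinant with a further double node at `1`. -/
theorem exists_le_slopeDet (hσ : 0 < σ) {s : Fin (2 * k + 2) → ℝ} (hs : StrictMono s)
    (ht : IsSeparated t d) (hε : 2 * d ≤ ε) :
    ∃ c > (0 : ℝ), ∀ x ∈ farSet t ε, c ≤ slopeDet σ s x x t t := by
  obtain ⟨c, hc, h⟩ := exists_le_windowDet hσ hs ht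
  have hSx : Continuous fun x => slopeDet σ s x x t t :=
    continuous_slopeDet continuous_id continuous_id s continuous_const continuous_const
  refine ⟨c, hc, le_on_farSet continuous_const hSx ?_⟩
  intro x hx
  have h1 := (h x (Set.Ioo_subset_Icc_self hx.1) 1 ⟨zero_le_one, le_rfl⟩
    (fun i => hε.trans (lt_abs_sub_of_notMem hx.1 hx.2 i).le) ht.one_far hx.1.2.le).2
  rw [windowDet_one_right, mul_comm] at h1
  exact le_of_mul_le_mul_left h1 (sub_pos.2 hx.1.2)

/-- The strict inequality at the limiting configuration persists for nearby pairs, uniformly in `x`.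
The only point where the limiting inequality can be an equality is `x = 1`, with `f₁ = fbar`; then
both sides have the factor `1 - x`, and dividing it out makes the inequality strict. -/
theorem eventually_windowDet_nonneg (hσ : 0 < σ) {s : Fin (2 * k + 2) → ℝ}
    (hs : StrictMono s) (ht : IsSeparated t d) (hd : 2 * d ≤ ε) {f₀ f₁ fbar : ℝ}
    (hfbar : 0 < fbar) (hA : FBarCondition σ ε t s f₀ f₁ fbar) :
    ∀ᶠ pq : (Fin k → ℝ) × (Fin k → ℝ) in 𝓝 (t, t), ∀ x ∈ farSet t ε,
      0 ≤ f₀ * windowDet σ s x 1 pq.1 pq.2 + f₁ * windowDet σ s 0 x pq.1 pq.2 -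
        fbar * windowDet σ s 0 1 pq.1 pq.2 := by
  obtain ⟨c₁, hc₁, hW⟩ := exists_le_windowDet hσ hs ht
  obtain ⟨c₂, hc₂, hS⟩ := exists_le_slopeDet hσ hs ht hd
  obtain ⟨c, hcf, hc⟩ := hA
  set δ := f₀ - c * fbar with hδ
  have hδ0 : 0 < δ := by
    rw [lt_div_iff₀ hfbar] at hcf; linarith
  let Ψ : ℝ → (Fin k → ℝ) × (Fin k → ℝ) → ℝ := fun x pq =>
    f₀ * windowDet σ s x 1 pq.1 pq.2 + f₁ * windowDet σ s 0 x pq.1 pq.2 -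
        fbar * windowDet σ s 0 1 pq.1 pq.2
  have hΨc : Continuous fun z : ((Fin k → ℝ) × (Fin k → ℝ)) × ℝ => Ψ z.2 z.1 := by
    have hp : Continuous fun z : ((Fin k → ℝ) × (Fin k → ℝ)) × ℝ => z.1.1 := by fun_prop
    have hq : Continuous fun z : ((Fin k → ℝ) × (Fin k → ℝ)) × ℝ => z.1.2 := by fun_prop
    exact ((continuous_const.mul (continuous_windowDet continuous_snd continuous_const s hp hq)).add
      (continuous_const.mul (continuous_windowDet continuous_const continuous_snd s hp hq))).sub
      (continuous_const.mul (continuous_windowDet continuous_const continuous_const s hp hq))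
  have hΨx : Continuous fun x => Ψ x (t, t) := continuous_section (f := Ψ) hΨc (t, t)
  -- The limiting condition with denominators cleared, on `(0, 1)` outside `T_ε`.
  have hlow' : ∀ x ∈ Set.Ioo (0 : ℝ) 1 \ nbhdAll t ε, δ * windowDet σ s x 1 t t ≤ Ψ x (t, t) := by
    intro x hx
    have h1 := (hW x (Set.Ioo_subset_Icc_self hx.1) 1 ⟨zero_le_one, le_rfl⟩
      (fun i => hd.trans (lt_abs_sub_of_notMem hx.1 hx.2 i).le) ht.one_far hx.1.2.le).2
    have h2 : 0 < windowDet σ s x 1 t t := (mul_pos hc₁ (sub_pos.2 hx.1.2)).trans_le h1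
    have h3 := hc x hx
    rw [borderedDet_eq, borderedDet_eq, borderedDet_eq, div_le_iff₀ h2] at h3
    have h4 := mul_le_mul_of_nonneg_left h3 hfbar.le
    have h5 : fbar * (windowDet σ s 0 1 t t - f₁ / fbar * windowDet σ s 0 x t t) =
        fbar * windowDet σ s 0 1 t t - f₁ * windowDet σ s 0 x t t := by
      field_simp
    rw [h5] at h4
    simp only [Ψ, hδ]
    linarith
  have hlow : ∀ x ∈ farSet t ε, δ * windowDet σ s x 1 t t ≤ Ψ x (t, t) :=
    le_on_farSet (continuous_const.mul
      (continuous_windowDet continuous_id continuous_const s continuous_const continuous_const))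
      hΨx hlow'
  by_cases hpos : ∀ x ∈ farSet t ε, 0 < Ψ x (t, t)
  · filter_upwards [eventually_forall_pos (f := Ψ) isCompact_farSet hΨc hpos] with pq hpq x hx
    exact (hpq x hx).le
  push Not at hpos
  obtain ⟨x, hx, hx0⟩ := hpos
  have hxf := farSet_subset hx
  have hx1 : x = 1 := by
    by_contra hne
    have hlt : x < 1 := lt_of_le_of_ne hxf.1.2 hne
    have h1 := (hW x hxf.1 1 ⟨zero_le_one, le_rfl⟩ (fun i => hd.trans (hxf.2 i)) ht.one_far
      hlt.le).2
    have h2 : 0 < windowDet σ s x 1 t t := (mul_pos hc₁ (sub_pos.2 hlt)).trans_le h1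
    have := hlow x hx
    have := mul_pos hδ0 h2
    linarith
  subst hx1
  have hf : f₁ = fbar := by
    have h1 := hlow 1 hx
    have h2 := (hW 0 ⟨le_rfl, zero_le_one⟩ 1 ⟨zero_le_one, le_rfl⟩ ht.zero_far ht.one_far
      zero_le_one).2
    rw [windowDet_self, mul_zero] at h1
    have h3 : Ψ 1 (t, t) = (f₁ - fbar) * windowDet σ s 0 1 t t := by
      simp only [Ψ, windowDet_self]; ring
    have h4 : Ψ 1 (t, t) = 0 := le_antisymm hx0 h1
    rw [h3] at h4
    rcases mul_eq_zero.1 h4 with h5 | h5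
    · linarith
    · linarith
  let Φ : ℝ → (Fin k → ℝ) × (Fin k → ℝ) → ℝ := fun x pq =>
    f₀ * slopeDet σ s x x pq.1 pq.2 - f₁ * slopeDet σ s 0 x pq.1 pq.2
  have hΨΦ : ∀ x pq, Ψ x pq = (1 - x) * Φ x pq := by
    intro x pq
    simp only [Ψ, Φ]
    rw [windowDet_one_right σ s x, windowDet_one σ s 0 x, hf]
    ring
  have hΦc : Continuous fun z : ((Fin k → ℝ) × (Fin k → ℝ)) × ℝ => Φ z.2 z.1 := by
    have hp : Continuous fun z : ((Fin k → ℝ) × (Fin k → ℝ)) × ℝ => z.1.1 := by fun_prop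
    have hq : Continuous fun z : ((Fin k → ℝ) × (Fin k → ℝ)) × ℝ => z.1.2 := by fun_prop
    exact (continuous_const.mul (continuous_slopeDet continuous_snd continuous_snd s hp hq)).sub
      (continuous_const.mul (continuous_slopeDet continuous_const continuous_snd s hp hq))
  have hΦlow : ∀ x ∈ farSet t ε, δ * slopeDet σ s x x t t ≤ Φ x (t, t) := by
    have hΦx : Continuous fun x => Φ x (t, t) := continuous_section (f := Φ) hΦc (t, t)
    have hSx : Continuous fun x => δ * slopeDet σ s x x t t := continuous_const.mul
      (continuous_slopeDet continuous_id continuous_id s continuous_const continuous_const)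
    refine le_on_farSet hSx hΦx ?_
    intro x hx
    have h1 := hlow' x hx
    rw [hΨΦ, windowDet_one_right] at h1
    refine le_of_mul_le_mul_left ?_ (sub_pos.2 hx.1.2)
    linarith
  have hΦpos : ∀ x ∈ farSet t ε, 0 < Φ x (t, t) := fun x hx =>
    (mul_pos hδ0 (hc₂.trans_le (hS x hx))).trans_le (hΦlow x hx)
  filter_upwards [eventually_forall_pos (f := Φ) isCompact_farSet hΦc hΦpos] with pq hpq x hx
  change 0 ≤ Ψ x pq
  rw [hΨΦ]
  exact mul_nonneg (sub_nonneg.2 (farSet_subset hx).1.2) (hpq x hx).le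

/-- For large ratios `f₀ / fbar` the first condition holds: both `N(0,1) - N(0,x)` and `N(x,1)` have
the factor `1 - x`, and the quotient of the remaining factors is bounded. -/
theorem exists_fBarCondition (hσ : 0 < σ) {s : Fin (2 * k + 2) → ℝ}
    (hs : StrictMono s) (ht : IsSeparated t d) (hd : 2 * d ≤ ε) :
    ∃ R > (0 : ℝ), ∀ f₀ f₁ fbar : ℝ, 0 < fbar → R < f₀ / fbar → fbar < f₁ →
      FBarCondition σ ε t s f₀ f₁ fbar := by
  obtain ⟨c₁, hc₁, hW⟩ := exists_le_windowDet hσ hs ht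
  obtain ⟨c₂, hc₂, hS⟩ := exists_le_slopeDet hσ hs ht hd
  obtain ⟨C, hC⟩ := isCompact_Icc.exists_bound_of_continuousOn (s := Set.Icc (0 : ℝ) 1)
    (continuous_slopeDet (σ := σ) continuous_const continuous_id s (p := fun _ => t)
      (q := fun _ => t) (a := fun _ => 0) continuous_const continuous_const).continuousOn
  refine ⟨(|C| + 1) / c₂, by positivity, fun f₀ f₁ fbar hfbar hR hlt => ⟨_, hR, fun x hx => ?_⟩⟩
  have hxI := Set.Ioo_subset_Icc_self hx.1
  have hfar : ∀ i, 2 * d ≤ |x - t i| := fun i => hd.trans (lt_abs_sub_of_notMem hx.1 hx.2 i).le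
  have h1x := sub_pos.2 hx.1.2
  have h1 := (hW x hxI 1 ⟨zero_le_one, le_rfl⟩ hfar ht.one_far hx.1.2.le).2
  have h2 : 0 < windowDet σ s x 1 t t := (mul_pos hc₁ h1x).trans_le h1
  have h3 := (hW 0 ⟨le_rfl, zero_le_one⟩ x hxI ht.zero_far hfar hx.1.1.le).2
  have h3' : 0 ≤ windowDet σ s 0 x t t :=
    (mul_nonneg hc₁.le (by linarith [hx.1.1])).trans h3
  have h4 := hS x (subset_closure hx)
  have h5 : slopeDet σ s 0 x t t ≤ |C| + 1 := by
    have := hC x hxI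
    rw [Real.norm_eq_abs, id] at this
    linarith [le_abs_self (slopeDet σ s 0 x t t), le_abs_self C]
  rw [borderedDet_eq, borderedDet_eq, borderedDet_eq, div_le_iff₀ h2]
  have h6 : 1 ≤ f₁ / fbar := (one_le_div hfbar).2 hlt.le
  rw [windowDet_one_right σ s x, windowDet_one σ s 0 x]
  have h7 : |C| + 1 ≤ (|C| + 1) / c₂ * slopeDet σ s x x t t := by
    rw [div_mul_eq_mul_div, le_div_iff₀ hc₂]
    exact mul_le_mul_of_nonneg_left h4 (by positivity)
  have h8 := mul_le_mul_of_nonneg_left (h5.trans h7) h1x.le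
  have h9 : windowDet σ s 0 x t t ≤ f₁ / fbar * windowDet σ s 0 x t t :=
    le_mul_of_one_le_left h3' h6
  linarith

theorem exists_fOneCondition (σ : ℝ) (t : Fin k → ℝ) (s : Fin (2 * k + 2) → ℝ) :
    ∃ R > (0 : ℝ), ∀ f₀ f₁ : ℝ, R < f₀ / f₁ → FOneCondition σ t s f₀ f₁ := by
  obtain ⟨R, hR, h⟩ := exists_ge_of_finite fun j => minorAtZero σ t s j / minorAtOne σ t s j
  exact ⟨R, hR, fun f₀ f₁ hf j => (h j).trans_lt hf⟩

end farSet

/-! ### The dual function without signs -/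

section systems

variable {k : ℕ} {σ ε d : ℝ} {t p q : Fin k → ℝ}

/-- As long as `x` does not separate any pair, no lower bound on its distance to the pairs is needed
for the window determinants in the expansion to be nonnegative. -/
theorem det_nodes₂_bounds {c : ℝ} (hc : 0 < c) {s : Fin (2 * k + 2) → ℝ}
    (hLB : ∀ x : Fin (2 * k + 2) → ℝ, (∀ i, x i ∈ Set.Icc (0 : ℝ) 1) →
      c * (Matrix.vandermonde x).det ^ 2 ≤
        (Matrix.vandermonde x).det * (collocation (gaussianWindow σ s) x).det)
    (ht : IsSeparated t d) (hn : IsNear t d p q) {x : ℝ} (hx : x ∈ Set.Ioo (0 : ℝ) 1)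
    (hxp : ∀ i, 0 < (p i - x) * (q i - x)) :
    0 < (Matrix.vandermonde (nodes₂ x 1 p q)).det ∧
      c * (Matrix.vandermonde (nodes₂ x 1 p q)).det ≤ gapProd p q * windowDet σ s x 1 p q ∧
      0 ≤ gapProd p q * windowDet σ s 0 x p q := by
  have hV := hn.vandermonde_interleave_pos ht
  have h0 := hn.pairProd_zero_pos ht
  have h1 := hn.pairProd_one_pos ht
  have h2 := pairProd_pos hxp
  have hV1 : 0 < (Matrix.vandermonde (nodes₂ x 1 p q)).det := by
    rw [vandermonde_nodes₂]
    have := sub_pos.2 hx.2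
    positivity
  have hV2 : 0 < (Matrix.vandermonde (nodes₂ 0 x p q)).det := by
    rw [vandermonde_nodes₂]
    have : 0 < x - 0 := by linarith [hx.1]
    positivity
  have hxI := Set.Ioo_subset_Icc_self hx
  rw [← det_window_nodes₂, ← det_window_nodes₂]
  refine ⟨hV1, vandermonde_le_gaussian_of_pos
    (hLB _ (hn.nodes₂_mem_Icc ht hxI ⟨zero_le_one, le_rfl⟩)) hV1.le hV1.ne', ?_⟩
  exact (mul_nonneg hc.le hV2.le).trans (vandermonde_le_gaussian_of_pos
    (hLB _ (hn.nodes₂_mem_Icc ht ⟨le_rfl, zero_le_one⟩ hxI)) hV2.le hV2.ne')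

theorem collocation_succAbove_zero {n : ℕ} (σ : ℝ) (s : Fin n → ℝ) (F : ℝ → ℝ) (x : Fin n → ℝ) :
    collocation (fun a => withWindows σ s F (Fin.succAbove 0 a)) x =
      collocation (gaussianWindow σ s) x := rfl

theorem collocation_succAbove_succ {n : ℕ} (σ : ℝ) (s : Fin (n + 1) → ℝ) (F : ℝ → ℝ)
    (j : Fin (n + 1)) (x : Fin (n + 1) → ℝ) :
    collocation (fun a => withWindows σ s F (Fin.succAbove j.succ a)) x =
      collocation (Fin.cons (α := fun _ => ℝ → ℝ) F (gaussianWindow σ (s ∘ j.succAbove))) x := by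
  ext r a
  refine Fin.cases ?_ (fun a => ?_) a
  · simp [collocation, withWindows]
  · simp [collocation, withWindows, Fin.succ_succAbove_succ, gaussianWindow]

/-- Finitely many continuous functions that do not vanish at `(t, t)` are bounded above and away
from zero near `(t, t)`. -/
theorem exists_bounds_of_continuous {ι : Type*} [Finite ι]
    (f : ι → (Fin k → ℝ) × (Fin k → ℝ) → ℝ) (hf : ∀ i, Continuous (f i))
    (h : ∀ i, f i (t, t) ≠ 0) :
    ∃ c > (0 : ℝ), ∃ C > (0 : ℝ), ∀ᶠ pq in 𝓝 (t, t), ∀ i, c ≤ |f i pq| ∧ |f i pq| ≤ C := by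
  obtain ⟨c, hc, hc'⟩ := exists_le_of_pos (fun i => |f i (t, t)|) fun i => abs_pos.2 (h i)
  obtain ⟨C, hC, hC'⟩ := exists_ge_of_finite fun i => |f i (t, t)|
  refine ⟨c / 2, by positivity, C + 1, by positivity, eventually_all.2 fun i => ?_⟩
  have hi := (hf i).abs.tendsto (t, t)
  have h1 : c / 2 < |f i (t, t)| := by linarith [hc' i]
  have h2 : |f i (t, t)| < C + 1 := by linarith [hC' i]
  filter_upwards [hi.eventually (eventually_gt_nhds h1), hi.eventually (eventually_lt_nhds h2)]
    with pq a b
  exact ⟨a.le, b.le⟩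

theorem dualF_zero (f₀ f₁ fbar ε : ℝ) (t : Fin k → ℝ) : dualF f₀ f₁ fbar ε t 0 = f₀ := by
  simp [dualF]

theorem dualF_one (f₀ f₁ fbar ε : ℝ) (t : Fin k → ℝ) : dualF f₀ f₁ fbar ε t 1 = f₁ := by
  simp [dualF]

theorem IsSeparated.mem_Ioo_of_near (ht : IsSeparated t d) {y : ℝ} {i : Fin k}
    (h : |y - t i| ≤ d) : y ∈ Set.Ioo (0 : ℝ) 1 := by
  have h1 := abs_le.1 h
  have h2 := ht.left i
  have h3 := ht.right i
  have h4 := ht.pos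
  constructor <;> linarith

theorem dualF_near (f₀ f₁ fbar : ℝ) (ht : IsSeparated t d) (hd : 2 * d ≤ ε) {y : ℝ} {i : Fin k}
    (h : |y - t i| ≤ d) : dualF f₀ f₁ fbar ε t y = 0 := by
  have hy := ht.mem_Ioo_of_near h
  have hmem : y ∈ nbhdAll t ε :=
    Set.mem_iUnion.2 ⟨i, Set.Ioo_subset_Icc_self hy, h.trans (by linarith [ht.pos])⟩
  rw [dualF, if_neg hy.1.ne', if_neg hy.2.ne, if_pos hmem]

theorem exists_separated_two_mul_le (ht : StrictMono t) (ht01 : ∀ i, t i ∈ Set.Ioo (0 : ℝ) 1)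
    (hε : 0 < ε) : ∃ d, IsSeparated t d ∧ 2 * d ≤ ε := by
  have h : ∀ᶠ d in 𝓝[>] (0 : ℝ), 2 * d ≤ ε :=
    ((eventually_lt_nhds (b := ε / 2) (by positivity)).filter_mono nhdsWithin_le_nhds).mono
      fun d hd => by linarith
  exact ((exists_isSeparated ht ht01).and h).exists

theorem isTStarSystem_dualF (hk : 0 < k) (hσ : 0 < σ) (hε : 0 < ε) (ht : StrictMono t)
    (ht01 : ∀ i, t i ∈ Set.Ioo (0 : ℝ) 1) {s : Fin (2 * k + 2) → ℝ} (hs : StrictMono s)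
    {f₀ f₁ fbar : ℝ} (hf₀ : 0 < f₀) (hf₁ : 0 < f₁) (hfbar : 0 < fbar)
    (hA : FBarCondition σ ε t s f₀ f₁ fbar) (hB : FOneCondition σ t s f₀ f₁) :
    IsTStarSystem t (withWindows σ s (dualF f₀ f₁ fbar ε t)) := by
  obtain ⟨d, hsep, hd⟩ := exists_separated_two_mul_le ht ht01 hε
  obtain ⟨c₀, hc₀, hLB⟩ := exists_vandermonde_sq_le_gaussian hσ hs
  obtain ⟨c₁, hc₁, hW⟩ := exists_le_windowDet hσ hs hsep
  -- The minors, divided by `gapProd`.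
  let f : Fin (2 * k + 2 + 1) → (Fin k → ℝ) × (Fin k → ℝ) → ℝ := fun j pq =>
    Fin.cases (motive := fun _ => ℝ) (windowDet σ s 0 1 pq.1 pq.2)
      (fun j => f₀ * windowDet₁ σ (s ∘ j.succAbove) 1 pq.1 pq.2 -
        f₁ * windowDet₁ σ (s ∘ j.succAbove) 0 pq.1 pq.2) j
  have hfc : ∀ j, Continuous (f j) := by
    intro j
    refine Fin.cases ?_ (fun j => ?_) j
    · exact continuous_windowDet continuous_const continuous_const s continuous_fst continuous_snd
    · exact (continuous_const.mul (continuous_windowDet₁ continuous_const _ continuous_fst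
        continuous_snd)).sub (continuous_const.mul (continuous_windowDet₁ continuous_const _
        continuous_fst continuous_snd))
  have hf0 : ∀ j, f j (t, t) ≠ 0 := by
    intro j
    refine Fin.cases ?_ (fun j => ?_) j
    · have := (hW 0 ⟨le_rfl, zero_le_one⟩ 1 ⟨zero_le_one, le_rfl⟩ hsep.zero_far hsep.one_far
        zero_le_one).2
      exact ne_of_gt (lt_of_lt_of_le (by linarith) this)
    · obtain ⟨c, hc, -, h⟩ := exists_le_windowDet₁ hσ
        (hs.comp (Fin.strictMono_succAbove j)) hsep
      have hb := hB j
      rw [minorAtZero_eq, minorAtOne_eq, div_lt_div_iff₀ (hc.trans_le h) hf₁] at hb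
      simp only [f, Fin.cases_succ]
      exact ne_of_gt (by linarith)
  obtain ⟨c, hc, C, hC, hev⟩ := exists_bounds_of_continuous f hfc hf0
  refine isTStarSystem_of_eventually hk ht ht01 hc hC ?_ ?_
  · filter_upwards [eventually_windowDet_nonneg hσ hs hsep hd hfbar hA,
      eventually_isNear hsep.pos] with pq hΨ hnear hlt x hx hxp
    have hn := hnear hlt
    obtain ⟨hV, h1, h2⟩ := det_nodes₂_bounds hc₀ hLB hsep hn hx hxp
    have hG := hn.gapProd_pos
    rw [withWindows, det_cons_nodes₃ _ (fun i => dualF_near _ _ _ hsep hd (hn.left i))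
      (fun i => dualF_near _ _ _ hsep hd (hn.right i)), dualF_zero, dualF_one,
      det_window_nodes₂, det_window_nodes₂, det_window_nodes₂, windowDet_swap σ s 0 x]
    by_cases hmem : x ∈ nbhdAll t ε
    · have hFx : dualF f₀ f₁ fbar ε t x = 0 := by
        rw [dualF, if_neg hx.1.ne', if_neg hx.2.ne, if_pos hmem]
      rw [hFx]
      have h3 : 0 ≤ gapProd pq.1 pq.2 * windowDet σ s x 1 pq.1 pq.2 :=
        (mul_nonneg hc₀.le hV.le).trans h1
      have h4 := mul_nonneg hf₀.le h3
      have h5 := mul_nonneg hf₁.le h2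
      linarith
    · have hFx : dualF f₀ f₁ fbar ε t x = fbar := by
        rw [dualF, if_neg hx.1.ne', if_neg hx.2.ne, if_neg hmem]
      rw [hFx]
      have h3 := mul_nonneg hG.le (hΨ x (subset_closure ⟨hx, hmem⟩))
      linarith
  · filter_upwards [hev, eventually_isNear hsep.pos] with pq hpq hnear hlt j
    have hn := hnear hlt
    have hG := hn.gapProd_pos
    have key : (collocation (fun a => withWindows σ s (dualF f₀ f₁ fbar ε t) (Fin.succAbove j a))
        (nodes₂ 0 1 pq.1 pq.2)).det = gapProd pq.1 pq.2 * f j pq := by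
      refine Fin.cases ?_ (fun j => ?_) j
      · rw [collocation_succAbove_zero, det_window_nodes₂]
        rfl
      · rw [collocation_succAbove_succ,
          det_cons_nodes₂ _ (fun i => dualF_near _ _ _ hsep hd (hn.left i))
          (fun i => dualF_near _ _ _ hsep hd (hn.right i)), dualF_zero, dualF_one,
          det_window_nodes₁, det_window_nodes₁]
        simp only [f, Fin.cases_succ]
        ring
    rw [key, abs_mul, abs_of_pos hG, mul_comm c, mul_comm C]
    exact ⟨mul_le_mul_of_nonneg_left (hpq j).1 hG.le, mul_le_mul_of_nonneg_left (hpq j).2 hG.le⟩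

end systems

/-! ### The dual functions with sign patterns -/

section signed

variable {k : ℕ} {σ ε d : ℝ} {t p q : Fin k → ℝ}

/-- A smooth function that is `1` within distance `r` of `c` and vanishes from distance `r'` on. -/
theorem exists_bump (c : ℝ) {r r' : ℝ} (hr : 0 < r) (hr' : r < r') :
    ∃ b : ℝ → ℝ, ContDiff ℝ (⊤ : ℕ∞) b ∧ (∀ x, |x - c| ≤ r → b x = 1) ∧
      ∀ x, r' ≤ |x - c| → b x = 0 := by
  let B : ContDiffBump c := ⟨r, r', hr, hr'⟩
  exact ⟨B, B.contDiff, fun x hx => B.one_of_mem_closedBall (by simpa [Real.dist_eq] using hx),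
    fun x hx => B.zero_of_le_dist (by simpa [Real.dist_eq] using hx)⟩

theorem dualFSign_zero (f₀ f₁ e ε : ℝ) (t : Fin k → ℝ) (π : Fin k → ℤˣ) :
    dualFSign f₀ f₁ e ε t π 0 = f₀ := by
  simp [dualFSign]

theorem dualFSign_one (f₀ f₁ e ε : ℝ) (t : Fin k → ℝ) (π : Fin k → ℤˣ) :
    dualFSign f₀ f₁ e ε t π 1 = f₁ := by
  simp [dualFSign]

theorem dualFSign_of_mem (f₀ f₁ e : ℝ) (π : Fin k → ℤˣ) {x : ℝ} (hx : x ∈ Set.Ioo (0 : ℝ) 1)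
    (h : x ∈ nbhdAll t ε) :
    ∃ i, x ∈ nbhd t ε i ∧ dualFSign f₀ f₁ e ε t π x = ((π i : ℤˣ) : ℤ) := by
  have h' := Set.mem_iUnion.1 h
  refine ⟨h'.choose, h'.choose_spec, ?_⟩
  rw [dualFSign, if_neg hx.1.ne', if_neg hx.2.ne, dif_pos h']

theorem dualFSign_of_notMem (f₀ f₁ e : ℝ) (π : Fin k → ℤˣ) {x : ℝ} (hx : x ∈ Set.Ioo (0 : ℝ) 1)
    (h : x ∉ nbhdAll t ε) : dualFSign f₀ f₁ e ε t π x = e := by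
  rw [dualFSign, if_neg hx.1.ne', if_neg hx.2.ne, dif_neg fun h' => h (Set.mem_iUnion.2 h')]

/-- The distance between two of the `t_i`, in a form independent of their order. -/
theorem two_mul_le_abs_sub (hsep : ∀ i j, i < j → t i + 2 * ε ≤ t j) {i j : Fin k} (h : i ≠ j) :
    2 * ε ≤ |t i - t j| := by
  rcases lt_or_gt_of_ne h with h | h
  · rw [abs_sub_comm]; exact le_trans (by linarith [hsep _ _ h]) (le_abs_self _)
  · exact le_trans (by linarith [hsep _ _ h]) (le_abs_self _)

theorem dualFSign_near (f₀ f₁ e : ℝ) (π : Fin k → ℤˣ) (ht : IsSeparated t d) (hd : 2 * d ≤ ε)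
    (hsep : ∀ i j, i < j → t i + 2 * ε ≤ t j) {y : ℝ} {i : Fin k} (h : |y - t i| ≤ d) :
    dualFSign f₀ f₁ e ε t π y = ((π i : ℤˣ) : ℤ) := by
  have hy := ht.mem_Ioo_of_near h
  have hd0 := ht.pos
  have hmem : y ∈ nbhdAll t ε :=
    Set.mem_iUnion.2 ⟨i, Set.Ioo_subset_Icc_self hy, h.trans (by linarith)⟩
  obtain ⟨j, hj, hF⟩ := dualFSign_of_mem f₀ f₁ e π hy hmem
  have hij : j = i := by
    by_contra hne
    have h1 := two_mul_le_abs_sub hsep hne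
    have h2 := abs_sub_le (t j) y (t i)
    have h3 := hj.2
    rw [abs_sub_comm] at h3
    linarith
  rw [hF, hij]

/-- A smooth function with the values `π_i` near `t_i`, where `near i` and `wide i` are bump
functions at `t_i`; the wide one is used for the index `o`, if any. -/
def patternFn (near wide : Fin k → ℝ → ℝ) (π : Fin k → ℤˣ) (o : Option (Fin k)) (x : ℝ) : ℝ :=
  ∑ i, ((π i : ℤˣ) : ℤ) * (if o = some i then wide i x else near i x)

theorem patternFn_eq {near wide : Fin k → ℝ → ℝ} {π : Fin k → ℤˣ} {o : Option (Fin k)} {x : ℝ}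
    {i : Fin k} (h1 : near i x = 1) (h2 : wide i x = 1) (h3 : ∀ j, j ≠ i → near j x = 0)
    (h4 : ∀ j, j ≠ i → wide j x = 0) : patternFn near wide π o x = ((π i : ℤˣ) : ℤ) := by
  rw [patternFn, Finset.sum_eq_single i]
  · simp [h1, h2]
  · intro j _ hj
    simp [h3 j hj, h4 j hj]
  · simp

theorem contDiff_patternFn {near wide : Fin k → ℝ → ℝ} (h1 : ∀ i, ContDiff ℝ (⊤ : ℕ∞) (near i))
    (h2 : ∀ i, ContDiff ℝ (⊤ : ℕ∞) (wide i)) (π : Fin k → ℤˣ) (o : Option (Fin k)) :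
    ContDiff ℝ (⊤ : ℕ∞) (patternFn near wide π o) := by
  unfold patternFn
  refine ContDiff.sum fun i _ => contDiff_const.mul ?_
  by_cases h : o = some i
  · simpa [h] using h2 i
  · simpa [h] using h1 i

theorem IsNear.mem_closedBall (hn : IsNear t d p q) :
    (p, q) ∈ Metric.closedBall ((t, t) : (Fin k → ℝ) × (Fin k → ℝ)) |d| := by
  rw [Metric.mem_closedBall, Prod.dist_eq]
  exact max_le ((dist_pi_le_iff (abs_nonneg d)).2 fun i => (hn.left i).trans (le_abs_self d))
    ((dist_pi_le_iff (abs_nonneg d)).2 fun i => (hn.right i).trans (le_abs_self d))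

theorem exists_bound_windowDet₁ (σ : ℝ) (s : Fin (2 * k + 1) → ℝ) (t : Fin k → ℝ) (d a : ℝ) :
    ∃ C > (0 : ℝ), ∀ p q, IsNear t d p q → |windowDet₁ σ s a p q| ≤ C := by
  obtain ⟨C, hC⟩ := (isCompact_closedBall ((t, t) : (Fin k → ℝ) × (Fin k → ℝ)) |d|)
    |>.exists_bound_of_continuousOn
    (continuous_windowDet₁ (σ := σ) (a := fun _ => a) continuous_const s continuous_fst
      continuous_snd).continuousOn
  refine ⟨|C| + 1, by positivity, fun p q hn => ?_⟩
  have := hC _ hn.mem_closedBall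
  rw [Real.norm_eq_abs] at this
  linarith [le_abs_self C]

theorem exists_bound_slopeDet (σ : ℝ) (s : Fin (2 * k + 2) → ℝ) (t : Fin k → ℝ) (d a : ℝ) :
    ∃ C > (0 : ℝ), ∀ p q, IsNear t d p q → ∀ x ∈ Set.Icc (0 : ℝ) 1,
      |slopeDet σ s a x p q| ≤ C := by
  have hc : Continuous fun z : ((Fin k → ℝ) × (Fin k → ℝ)) × ℝ => slopeDet σ s a z.2 z.1.1 z.1.2 :=
    continuous_slopeDet continuous_const continuous_snd s (continuous_fst.comp continuous_fst)
      (continuous_snd.comp continuous_fst)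
  obtain ⟨C, hC⟩ := ((isCompact_closedBall ((t, t) : (Fin k → ℝ) × (Fin k → ℝ)) |d|).prod
    (isCompact_Icc (a := (0 : ℝ)) (b := 1))).exists_bound_of_continuousOn hc.continuousOn
  refine ⟨|C| + 1, by positivity, fun p q hn x hx => ?_⟩
  have := hC ((p, q), x) ⟨hn.mem_closedBall, hx⟩
  rw [Real.norm_eq_abs] at this
  linarith [le_abs_self C]

theorem exists_separated_pattern (ht : StrictMono t) (ht01 : ∀ i, t i ∈ Set.Ioo (0 : ℝ) 1)
    (hε : 0 < ε) (hin : ∀ i, ε < t i ∧ t i + ε < 1) :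
    ∃ d, IsSeparated t d ∧ 2 * d ≤ ε ∧ ∀ i, ε + d ≤ t i ∧ t i + ε + d ≤ 1 := by
  have small : ∀ c : ℝ, 0 < c → ∀ᶠ d in 𝓝[>] (0 : ℝ), d ≤ c := fun c hc =>
    ((eventually_lt_nhds hc).filter_mono nhdsWithin_le_nhds).mono fun d hd => hd.le
  have h2 : ∀ᶠ d in 𝓝[>] (0 : ℝ), ∀ i, d ≤ t i - ε :=
    eventually_all.2 fun i => small _ (sub_pos.2 (hin i).1)
  have h3 : ∀ᶠ d in 𝓝[>] (0 : ℝ), ∀ i, d ≤ 1 - (t i + ε) :=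
    eventually_all.2 fun i => small _ (sub_pos.2 (hin i).2)
  obtain ⟨d, a, b, c, e⟩ := ((exists_isSeparated ht ht01).and
    ((small (ε / 2) (by positivity)).and (h2.and h3))).exists
  exact ⟨d, a, by linarith, fun i => ⟨by linarith [c i], by linarith [e i]⟩⟩

/-- Smooth functions `h π o` for the sign patterns `π`. They agree with `F^π` at points within
distance `d` of the `t_i`, vanish at `0` and `1`, and agree with `F^π` at further points of
`T_{i,ε}` for `o = some i`, while `h π none` vanishes outside `T_ε`. Neighbouring intervals may
touch, so no smooth function does this for all `i` at once. -/
structure IsPatternFamily (t : Fin k → ℝ) (d ε : ℝ)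
    (h : (Fin k → ℤˣ) → Option (Fin k) → ℝ → ℝ) : Prop where
  contDiff : ∀ π o, ContDiff ℝ (⊤ : ℕ∞) (h π o)
  near : ∀ π o i y, |y - t i| ≤ d → h π o y = ((π i : ℤˣ) : ℤ)
  zero : ∀ π o, h π o 0 = 0
  one : ∀ π o, h π o 1 = 0
  far : ∀ π x, x ∈ Set.Ioo (0 : ℝ) 1 → x ∉ nbhdAll t ε → h π none x = 0
  mem : ∀ π i x, x ∈ nbhd t ε i → h π (some i) x = ((π i : ℤˣ) : ℤ)

theorem exists_isPatternFamily (hε : 0 < ε) (ht01 : ∀ i, t i ∈ Set.Ioo (0 : ℝ) 1)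
    (hS : IsSeparated t d) (hd : 2 * d ≤ ε) (hin' : ∀ i, ε + d ≤ t i ∧ t i + ε + d ≤ 1)
    (hsep : ∀ i j, i < j → t i + 2 * ε ≤ t j) : ∃ h, IsPatternFamily t d ε h := by
  have hd0 := hS.pos
  choose near hnear hnear1 hnear0 using fun i => exists_bump (t i) hd0 (by linarith : d < 2 * d)
  choose wide hwide hwide1 hwide0 using fun i => exists_bump (t i) hε (by linarith : ε < ε + d)
  refine ⟨patternFn near wide, contDiff_patternFn hnear hwide, ?_, ?_, ?_, ?_, ?_⟩
  · intro π o i y hy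
    have far : ∀ j, j ≠ i → 2 * ε - d ≤ |y - t j| := by
      intro j hj
      have h1 := two_mul_le_abs_sub hsep hj.symm
      have h2 := abs_sub_le (t i) y (t j)
      rw [abs_sub_comm] at hy
      linarith
    exact patternFn_eq (hnear1 i y hy) (hwide1 i y (hy.trans (by linarith)))
      (fun j hj => hnear0 j y (by linarith [far j hj]))
      fun j hj => hwide0 j y (by linarith [far j hj])
  · intro π o
    refine Finset.sum_eq_zero fun i _ => ?_
    have h1 : |0 - t i| = t i := by rw [zero_sub, abs_neg, abs_of_pos (ht01 i).1]
    rw [hnear0 i 0 (hS.zero_far i), hwide0 i 0 (by rw [h1]; exact (hin' i).1)]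
    simp
  · intro π o
    refine Finset.sum_eq_zero fun i _ => ?_
    have h1 : |1 - t i| = 1 - t i := abs_of_pos (sub_pos.2 (ht01 i).2)
    rw [hnear0 i 1 (hS.one_far i), hwide0 i 1 (by rw [h1]; linarith [(hin' i).2])]
    simp
  · intro π x hx hx'
    refine Finset.sum_eq_zero fun i _ => ?_
    have := lt_abs_sub_of_notMem hx hx' i
    rw [hnear0 i x (by linarith)]
    simp
  · intro π i x hx
    rw [patternFn, Finset.sum_eq_single i]
    · simp [hwide1 i x hx.2]
    · intro j _ hj
      have h1 := two_mul_le_abs_sub hsep hj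
      have h2 := abs_sub_le (t j) x (t i)
      have h3 := hx.2
      rw [abs_sub_comm (t j) x] at h2
      simp [hj.symm, hnear0 j x (by linarith)]
    · simp

/-- For `f₀` large, the term of `f₀` in the expansion dominates the contributions of the signs and
of `e`. For `x` close to a pair this relies on the bounds by Vandermonde determinants being uniform
up to triple nodes. -/
theorem exists_det_dualFSign_nonpos (hσ : 0 < σ) {s : Fin (2 * k + 2) → ℝ} (hs : StrictMono s)
    (hS : IsSeparated t d) (hd : 2 * d ≤ ε) (hsep : ∀ i j, i < j → t i + 2 * ε ≤ t j)
    {h : (Fin k → ℤˣ) → Option (Fin k) → ℝ → ℝ} (hh : IsPatternFamily t d ε h) :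
    ∃ R > (0 : ℝ), ∀ f₀ f₁ fbar : ℝ, 0 < f₀ → 0 < f₁ → 0 < fbar → R < f₀ / fbar → R < f₀ →
      ∀ e : ℝ, |e| ≤ fbar → e < f₁ → ∀ π : Fin k → ℤˣ,
        ∀ᶠ pq : (Fin k → ℝ) × (Fin k → ℝ) in 𝓝 (t, t), (∀ i, pq.1 i < pq.2 i) →
          ∀ x ∈ Set.Ioo (0 : ℝ) 1, (∀ i, 0 < (pq.1 i - x) * (pq.2 i - x)) →
            (collocation (withWindows σ s (dualFSign f₀ f₁ e ε t π))
              (nodes₃ x 0 1 pq.1 pq.2)).det ≤ 0 := by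
  have hd0 := hS.pos
  obtain ⟨c₀, hc₀, hLB⟩ := exists_vandermonde_sq_le_gaussian hσ hs
  obtain ⟨c₂, hc₂, hV₂⟩ := exists_le_vandermonde_nodes₂ hS
  obtain ⟨C₂, hC₂, hslope⟩ := exists_bound_slopeDet σ s t d 0
  choose A hA0 hA using fun a : (Fin k → ℤˣ) × Option (Fin k) =>
    exists_abs_det_cons_gaussian_le (σ := σ) s (hh.contDiff a.1 a.2)
  obtain ⟨C₁, hC₁, hAC⟩ := exists_ge_of_finite A
  refine ⟨max (2 * C₁ / c₀) (2 * (C₂ / c₂) / c₀), lt_max_of_lt_left (by positivity),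
    fun f₀ f₁ fbar hf₀ hf₁ hfbar hRb hRf₀ e he hef π => ?_⟩
  have hq1 : 2 * C₁ < f₀ * c₀ := (div_lt_iff₀ hc₀).1 ((le_max_left _ _).trans_lt hRf₀)
  have hq2 : 2 * (C₂ / c₂) * fbar < f₀ * c₀ := by
    have := (lt_div_iff₀ hfbar).1 ((le_max_right _ _).trans_lt hRb)
    rw [div_mul_eq_mul_div, div_lt_iff₀ hc₀] at this
    exact this
  set F := dualFSign f₀ f₁ e ε t π with hF
  have hFp : ∀ o i y, |y - t i| ≤ d → F y - h π o y = 0 := by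
    intro o i y hy
    rw [hF, dualFSign_near f₀ f₁ e π hS hd hsep hy, hh.near π o i y hy, sub_self]
  have hF0 : ∀ o, F 0 - h π o 0 = f₀ := fun o => by rw [hh.zero, sub_zero, hF, dualFSign_zero]
  have hF1 : ∀ o, F 1 - h π o 1 = f₁ := fun o => by rw [hh.one, sub_zero, hF, dualFSign_one]
  filter_upwards [eventually_isNear hd0] with pq hnr hlt x hx hxp
  have hn := hnr hlt
  have hxI := Set.Ioo_subset_Icc_self hx
  obtain ⟨hV, h1, h2⟩ := det_nodes₂_bounds hc₀ hLB hS hn hx hxp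
  have hG := hn.gapProd_pos
  -- The contribution of the pattern function is controlled by the term of `f₀`.
  have hpat : ∀ o, |(collocation (Fin.cons (α := fun _ => ℝ → ℝ) (h π o) (gaussianWindow σ s))
      (nodes₃ x 0 1 pq.1 pq.2)).det| ≤
      C₁ * (Matrix.vandermonde (nodes₂ x 1 pq.1 pq.2)).det := by
    intro o
    refine (hA (π, o) _ (hn.nodes₃_mem_Icc hS hxI ⟨le_rfl, zero_le_one⟩
      ⟨zero_le_one, le_rfl⟩)).trans (mul_le_mul (hAC (π, o)) ?_ (abs_nonneg _) hC₁.le)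
    have e3 : (Matrix.vandermonde (nodes₃ x 0 1 pq.1 pq.2)).det =
        -(x * pairProd pq.1 pq.2 0) * (Matrix.vandermonde (nodes₂ x 1 pq.1 pq.2)).det := by
      rw [vandermonde_nodes₃, vandermonde_nodes₂]; ring
    rw [e3, abs_mul, abs_neg, abs_of_pos hV, abs_mul, abs_of_pos hx.1]
    have h4 := hn.abs_pairProd_le_one hS (a := 0) ⟨le_rfl, zero_le_one⟩
    exact mul_le_of_le_one_left hV.le (mul_le_one₀ hx.2.le (abs_nonneg _) h4)
  have key : ∀ o, (collocation (withWindows σ s F) (nodes₃ x 0 1 pq.1 pq.2)).det =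
      (F x - h π o x) * (gapProd pq.1 pq.2 * windowDet σ s 0 1 pq.1 pq.2) -
      f₀ * (gapProd pq.1 pq.2 * windowDet σ s x 1 pq.1 pq.2) -
      f₁ * (gapProd pq.1 pq.2 * windowDet σ s 0 x pq.1 pq.2) +
      (collocation (Fin.cons (α := fun _ => ℝ → ℝ) (h π o) (gaussianWindow σ s))
      (nodes₃ x 0 1 pq.1 pq.2)).det := by
    intro o
    rw [withWindows, det_collocation_cons_add (F := F) (F' := fun y => F y - h π o y)
      (h := h π o) _ fun r => (sub_add_cancel _ _).symm,
      det_cons_nodes₃ (F := fun y => F y - h π o y) _ (fun i => hFp o i _ (hn.left i))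
      (fun i => hFp o i _ (hn.right i)), hF0, hF1,
      det_window_nodes₂, det_window_nodes₂, det_window_nodes₂, windowDet_swap σ s 0 x]
    ring
  have h5 := mul_le_mul_of_nonneg_left h1 hf₀.le
  have h6 := mul_nonneg hf₁.le h2
  have h7 : 2 * C₁ * (Matrix.vandermonde (nodes₂ x 1 pq.1 pq.2)).det ≤
      f₀ * c₀ * (Matrix.vandermonde (nodes₂ x 1 pq.1 pq.2)).det :=
    mul_le_mul_of_nonneg_right hq1.le hV.le
  by_cases hxmem : x ∈ nbhdAll t ε
  · obtain ⟨i, hi, hFx⟩ := dualFSign_of_mem f₀ f₁ e π hx hxmem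
    rw [key (some i), hh.mem π i x hi, hF, hFx, sub_self, zero_mul]
    have h8 := (abs_le.1 (hpat (some i))).2
    have h9 := mul_nonneg hC₁.le hV.le
    linarith
  · rw [key none, hh.far π x hx hxmem, hF, dualFSign_of_notMem f₀ f₁ e π hx hxmem, sub_zero,
      windowDet_one σ s 0 x]
    have h8 := (abs_le.1 (hpat none)).2
    have hfar : ∀ i, 2 * d ≤ |x - t i| := fun i =>
      hd.trans (lt_abs_sub_of_notMem hx hxmem i).le
    have h9 := hV₂ x 1 hfar hS.one_far hx.2.le _ _ hn
    have h10 := hslope _ _ hn x hxI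
    have h1x := sub_pos.2 hx.2
    -- The differences of the window determinants carry the factor `1 - x` of `windowDet x 1`.
    have h11 : e * (gapProd pq.1 pq.2 * ((1 - x) * slopeDet σ s 0 x pq.1 pq.2)) ≤
        fbar * (C₂ / c₂) * (Matrix.vandermonde (nodes₂ x 1 pq.1 pq.2)).det := by
      calc e * (gapProd pq.1 pq.2 * ((1 - x) * slopeDet σ s 0 x pq.1 pq.2))
          ≤ |e * (gapProd pq.1 pq.2 * ((1 - x) * slopeDet σ s 0 x pq.1 pq.2))| := le_abs_self _
        _ = |e| * (gapProd pq.1 pq.2 * ((1 - x) * |slopeDet σ s 0 x pq.1 pq.2|)) := by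
          rw [abs_mul, abs_mul, abs_mul, abs_of_pos hG, abs_of_pos h1x]
        _ ≤ fbar * (gapProd pq.1 pq.2 * ((1 - x) * C₂)) := by gcongr
        _ = fbar * (C₂ / c₂) * (c₂ * (1 - x) * gapProd pq.1 pq.2) := by field_simp
        _ ≤ _ := mul_le_mul_of_nonneg_left h9 (by positivity)
    have h12 := mul_nonneg (sub_pos.2 hef).le h2
    have h13 : 2 * (C₂ / c₂) * fbar * (Matrix.vandermonde (nodes₂ x 1 pq.1 pq.2)).det ≤
        f₀ * c₀ * (Matrix.vandermonde (nodes₂ x 1 pq.1 pq.2)).det :=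
      mul_le_mul_of_nonneg_right hq2.le hV.le
    rw [mul_add, mul_add]
    linarith

/-- For `f₀` large, the term of `f₀` dominates the expansion of the minors. -/
theorem exists_minor_dualFSign_bounds (hσ : 0 < σ) {s : Fin (2 * k + 2) → ℝ} (hs : StrictMono s)
    (hS : IsSeparated t d) (hd : 2 * d ≤ ε) (hsep : ∀ i j, i < j → t i + 2 * ε ≤ t j)
    {h : (Fin k → ℤˣ) → Option (Fin k) → ℝ → ℝ} (hh : IsPatternFamily t d ε h) :
    ∃ R > (0 : ℝ), ∀ f₀ f₁ : ℝ, 0 < f₀ → 0 < f₁ → R < f₀ / f₁ → R < f₀ →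
      ∀ (e : ℝ) (π : Fin k → ℤˣ), ∃ c > (0 : ℝ), ∃ C > (0 : ℝ),
        ∀ᶠ pq : (Fin k → ℝ) × (Fin k → ℝ) in 𝓝 (t, t), (∀ i, pq.1 i < pq.2 i) → ∀ j,
          c * gapProd pq.1 pq.2 ≤ |(collocation (fun a =>
            withWindows σ s (dualFSign f₀ f₁ e ε t π) (Fin.succAbove j a))
              (nodes₂ 0 1 pq.1 pq.2)).det| ∧
          |(collocation (fun a =>
            withWindows σ s (dualFSign f₀ f₁ e ε t π) (Fin.succAbove j a))
              (nodes₂ 0 1 pq.1 pq.2)).det| ≤ C * gapProd pq.1 pq.2 := by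
  have hd0 := hS.pos
  obtain ⟨c₁, hc₁, hW⟩ := exists_le_windowDet hσ hs hS
  have hss : ∀ j : Fin (2 * k + 2), StrictMono (s ∘ j.succAbove) := fun j =>
    hs.comp (Fin.strictMono_succAbove j)
  choose l hl0 hl _ using fun j => exists_le_windowDet₁ hσ (hss j) hS
  obtain ⟨c₃, hc₃, hlc⟩ := exists_le_of_pos l hl0
  choose B hB0 hB using fun j : Fin (2 * k + 2) =>
    exists_bound_windowDet₁ σ (s ∘ j.succAbove) t d 0
  obtain ⟨C₃, hC₃, hBC⟩ := exists_ge_of_finite B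
  choose B' hB'0 hB' using fun j : Fin (2 * k + 2) =>
    exists_bound_windowDet₁ σ (s ∘ j.succAbove) t d 1
  obtain ⟨C₄, hC₄, hBC'⟩ := exists_ge_of_finite B'
  choose D hD0 hD using fun a : Fin (2 * k + 2) × (Fin k → ℤˣ) =>
    exists_abs_det_cons_gaussian_le (σ := σ) (s ∘ a.1.succAbove) (hh.contDiff a.2 none)
  obtain ⟨C₅, hC₅, hDC⟩ := exists_ge_of_finite D
  refine ⟨max (2 * C₃ / c₃) (2 * C₅ / c₃), lt_max_of_lt_left (by positivity),
    fun f₀ f₁ hf₀ hf₁ hRf hRf₀ e π => ?_⟩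
  have hq3 : 2 * C₃ * f₁ < f₀ * c₃ := by
    have := (lt_div_iff₀ hf₁).1 ((le_max_left _ _).trans_lt hRf)
    rw [div_mul_eq_mul_div, div_lt_iff₀ hc₃] at this
    exact this
  have hq4 : 2 * C₅ < f₀ * c₃ := (div_lt_iff₀ hc₃).1 ((le_max_right _ _).trans_lt hRf₀)
  set F := dualFSign f₀ f₁ e ε t π with hF
  have hFp : ∀ o i y, |y - t i| ≤ d → F y - h π o y = 0 := by
    intro o i y hy
    rw [hF, dualFSign_near f₀ f₁ e π hS hd hsep hy, hh.near π o i y hy, sub_self]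
  have hF0 : ∀ o, F 0 - h π o 0 = f₀ := fun o => by rw [hh.zero, sub_zero, hF, dualFSign_zero]
  have hF1 : ∀ o, F 1 - h π o 1 = f₁ := fun o => by rw [hh.one, sub_zero, hF, dualFSign_one]
  have hW01 : 0 < windowDet σ s 0 1 t t := by
    have := (hW 0 ⟨le_rfl, zero_le_one⟩ 1 ⟨zero_le_one, le_rfl⟩ hS.zero_far hS.one_far
      zero_le_one).2
    linarith
  obtain ⟨c₆, hc₆, C₆, hC₆, hev⟩ := exists_bounds_of_continuous (ι := Unit)
    (fun _ pq => windowDet σ s 0 1 pq.1 pq.2) (fun _ =>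
      continuous_windowDet continuous_const continuous_const s continuous_fst continuous_snd)
    fun _ => hW01.ne'
  have hc₇ : 0 < f₀ * c₃ - f₁ * C₃ - C₅ := by linarith
  refine ⟨min c₆ (f₀ * c₃ - f₁ * C₃ - C₅), lt_min hc₆ hc₇, max C₆ (f₀ * C₄ + f₁ * C₃ + C₅),
    lt_max_of_lt_left hC₆, ?_⟩
  filter_upwards [hev, eventually_isNear hd0] with pq hpq hnr hlt j
  have hn := hnr hlt
  have hG := hn.gapProd_pos
  refine Fin.cases ?_ (fun j => ?_) j
  · rw [collocation_succAbove_zero, det_window_nodes₂, abs_mul, abs_of_pos hG, mul_comm (min _ _),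
      mul_comm (max _ _)]
    exact ⟨mul_le_mul_of_nonneg_left ((min_le_left _ _).trans (hpq ()).1) hG.le,
      mul_le_mul_of_nonneg_left ((hpq ()).2.trans (le_max_left _ _)) hG.le⟩
  · rw [collocation_succAbove_succ,
      det_collocation_cons_add (F := F) (F' := fun y => F y - h π none y)
      (h := h π none) _ fun r => (sub_add_cancel _ _).symm,
      det_cons_nodes₂ (F := fun y => F y - h π none y) _ (fun i => hFp none i _ (hn.left i))
      (fun i => hFp none i _ (hn.right i)), hF0, hF1,
      det_window_nodes₁, det_window_nodes₁]
    set M := (collocation (Fin.cons (α := fun _ => ℝ → ℝ) (h π none)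
      (gaussianWindow σ (s ∘ j.succAbove))) (nodes₂ 0 1 pq.1 pq.2)).det with hM
    set G := gapProd pq.1 pq.2 with hGdef
    have h1 : c₃ ≤ windowDet₁ σ (s ∘ j.succAbove) 1 pq.1 pq.2 := (hlc j).trans (hl j _ _ hn)
    have h2 := ((hB j _ _ hn).trans (hBC j))
    have h3 := ((hB' j _ _ hn).trans (hBC' j))
    have h4 : |M| ≤ C₅ * G := by
      refine (hD (j, π) _ (hn.nodes₂_mem_Icc hS ⟨le_rfl, zero_le_one⟩
        ⟨zero_le_one, le_rfl⟩)).trans (mul_le_mul (hDC _) ?_ (abs_nonneg _) hC₅.le)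
      have hV := hn.vandermonde_interleave_pos hS
      obtain ⟨K, -, hVG⟩ := exists_mul_gapProd_le_vandermonde hS
      rw [vandermonde_nodes₂, sub_zero, one_mul, abs_mul, abs_mul, abs_of_pos hV]
      have h5 := hn.abs_pairProd_le_one hS (a := 0) ⟨le_rfl, zero_le_one⟩
      have h6 := hn.abs_pairProd_le_one hS (a := 1) ⟨zero_le_one, le_rfl⟩
      calc _ ≤ 1 * (1 * G) := by
            refine mul_le_mul h5 (mul_le_mul h6 (hVG _ _ hn).2 hV.le zero_le_one) ?_ zero_le_one
            positivity
        _ = G := by ring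
    have h2' := abs_le.1 h2
    have h3' := abs_le.1 h3
    have h4' := abs_le.1 h4
    have e1 : f₀ * c₃ * G ≤ f₀ * (G * windowDet₁ σ (s ∘ j.succAbove) 1 pq.1 pq.2) := by
      rw [mul_assoc, mul_comm c₃]; gcongr
    have e2 : f₀ * (G * windowDet₁ σ (s ∘ j.succAbove) 1 pq.1 pq.2) ≤ f₀ * C₄ * G := by
      rw [mul_assoc, mul_comm C₄]; gcongr; exact h3'.2
    have e3 : f₁ * (G * windowDet₁ σ (s ∘ j.succAbove) 0 pq.1 pq.2) ≤ f₁ * C₃ * G := by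
      rw [mul_assoc, mul_comm C₃]; gcongr; exact h2'.2
    have e4 : -(f₁ * C₃ * G) ≤ f₁ * (G * windowDet₁ σ (s ∘ j.succAbove) 0 pq.1 pq.2) := by
      have : -(f₁ * C₃ * G) = f₁ * (G * -C₃) := by ring
      rw [this]; gcongr; exact h2'.1
    have m1 := mul_le_mul_of_nonneg_right
      (min_le_right c₆ (f₀ * c₃ - f₁ * C₃ - C₅)) hG.le
    have m2 := mul_le_mul_of_nonneg_right
      (le_max_right C₆ (f₀ * C₄ + f₁ * C₃ + C₅)) hG.le
    have m3 := mul_nonneg (mul_nonneg hf₀.le hC₄.le) hG.le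
    have m4 := mul_pos (mul_pos hf₀ hc₃) hG
    refine ⟨le_trans ?_ (le_abs_self _), (abs_le.2 ⟨?_, ?_⟩).trans m2⟩
    · linarith
    · linarith
    · linarith

theorem isTStarSystem_dualFSign (hk : 0 < k) (hσ : 0 < σ) (hε : 0 < ε) (ht : StrictMono t)
    (ht01 : ∀ i, t i ∈ Set.Ioo (0 : ℝ) 1) {s : Fin (2 * k + 2) → ℝ} (hs : StrictMono s)
    (hin : ∀ i, ε < t i ∧ t i + ε < 1) (hsep : ∀ i j, i < j → t i + 2 * ε ≤ t j) :
    ∃ R > (0 : ℝ), ∀ f₀ f₁ fbar : ℝ, 0 < f₀ → 0 < f₁ → 0 < fbar → R < f₀ / fbar → R < f₀ / f₁ →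
      R < f₀ → ∀ e : ℝ, |e| ≤ fbar → e < f₁ → ∀ π : Fin k → ℤˣ,
        IsTStarSystem t (withWindows σ s (dualFSign f₀ f₁ e ε t π)) := by
  obtain ⟨d, hS, hd, hin'⟩ := exists_separated_pattern ht ht01 hε hin
  obtain ⟨h, hh⟩ := exists_isPatternFamily hε ht01 hS hd hin' hsep
  obtain ⟨R₁, hR₁, hdet⟩ := exists_det_dualFSign_nonpos hσ hs hS hd hsep hh
  obtain ⟨R₂, hR₂, hminor⟩ := exists_minor_dualFSign_bounds hσ hs hS hd hsep hh
  refine ⟨max R₁ R₂, lt_max_of_lt_left hR₁, fun f₀ f₁ fbar h₀ h₁ hb hRb hRf hR e he hef π => ?_⟩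
  obtain ⟨c, hc, C, hC, hev⟩ := hminor f₀ f₁ h₀ h₁ ((le_max_right _ _).trans_lt hRf)
    ((le_max_right _ _).trans_lt hR) e π
  exact isTStarSystem_of_eventually hk ht ht01 hc hC (hdet f₀ f₁ fbar h₀ h₁ hb
    ((le_max_left _ _).trans_lt hRb) ((le_max_left _ _).trans_lt hR) e he hef π) hev

end signed

/-! ### T*-systems from the dual functions -/

theorem mainTheorem6 (k : ℕ) (hk : 0 < k) (σ ε : ℝ) (hσ : 0 < σ) (hε : 0 < ε)
    (t : Fin k → ℝ) (ht : StrictMono t) (ht01 : ∀ i, t i ∈ Set.Ioo (0 : ℝ) 1)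
    (s : Fin (2 * k + 2) → ℝ) (hs : StrictMono s) :
    (∀ f₀ f₁ fbar : ℝ, 0 < f₀ → 0 < f₁ → 0 < fbar →
      FBarCondition σ ε t s f₀ f₁ fbar → FOneCondition σ t s f₀ f₁ →
      IsTStarSystem t (withWindows σ s (dualF f₀ f₁ fbar ε t))) ∧
    ∃ R > (0 : ℝ), ∀ f₀ f₁ fbar : ℝ, 0 < f₀ → 0 < f₁ → 0 < fbar →
      R < f₀ / fbar → R < f₀ / f₁ →
      (fbar < f₁ → FBarCondition σ ε t s f₀ f₁ fbar ∧ FOneCondition σ t s f₀ f₁) ∧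
      (R < f₀ → (∀ i, ε < t i ∧ t i + ε < 1) → (∀ i j, i < j → t i + 2 * ε ≤ t j) →
        ∀ e : ℝ, (e = fbar ∨ e = -fbar) → e < f₁ → ∀ π : Fin k → ℤˣ,
          IsTStarSystem t (withWindows σ s (dualFSign f₀ f₁ e ε t π))) := by
  refine ⟨fun f₀ f₁ fbar h₀ h₁ hb hA hB =>
    isTStarSystem_dualF hk hσ hε ht ht01 hs h₀ h₁ hb hA hB, ?_⟩
  obtain ⟨d, hS, hd⟩ := exists_separated_two_mul_le ht ht01 hε
  obtain ⟨R₁, hR₁, hA⟩ := exists_fBarCondition hσ hs hS hd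
  obtain ⟨R₂, hR₂, hB⟩ := exists_fOneCondition σ t s
  -- The hypotheses on the intervals do not involve `f₀, f₁, fbar`, so they may be assumed here.
  obtain ⟨R₃, hR₃, hP⟩ : ∃ R > (0 : ℝ), (∀ i, ε < t i ∧ t i + ε < 1) →
      (∀ i j, i < j → t i + 2 * ε ≤ t j) → ∀ f₀ f₁ fbar : ℝ, 0 < f₀ → 0 < f₁ → 0 < fbar →
      R < f₀ / fbar → R < f₀ / f₁ → R < f₀ → ∀ e : ℝ, |e| ≤ fbar → e < f₁ → ∀ π : Fin k → ℤˣ,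
        IsTStarSystem t (withWindows σ s (dualFSign f₀ f₁ e ε t π)) := by
    by_cases h : (∀ i, ε < t i ∧ t i + ε < 1) ∧ ∀ i j, i < j → t i + 2 * ε ≤ t j
    · obtain ⟨R, hR, h'⟩ := isTStarSystem_dualFSign hk hσ hε ht ht01 hs h.1 h.2
      exact ⟨R, hR, fun _ _ => h'⟩
    · exact ⟨1, one_pos, fun h1 h2 => absurd ⟨h1, h2⟩ h⟩
  refine ⟨max R₁ (max R₂ R₃), lt_max_of_lt_left hR₁,
    fun f₀ f₁ fbar h₀ h₁ hb hRb hRf => ⟨fun hlt => ⟨?_, ?_⟩, fun hR hin hsep e he hef π => ?_⟩⟩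
  · exact hA f₀ f₁ fbar hb ((le_max_left _ _).trans_lt hRb) hlt
  · exact hB f₀ f₁ (((le_max_left _ _).trans (le_max_right _ _)).trans_lt hRf)
  · have hle : R₃ ≤ max R₁ (max R₂ R₃) := (le_max_right _ _).trans (le_max_right _ _)
    refine hP hin hsep f₀ f₁ fbar h₀ h₁ hb (hle.trans_lt hRb) (hle.trans_lt hRf)
      (hle.trans_lt hR) e ?_ hef π
    rcases he with rfl | rfl
    · exact (abs_of_pos hb).le
    · rw [abs_neg, abs_of_pos hb]
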